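/- Let $\mathcal F$ be a C*-algebra (unital or not), let $\omega$ be a state of $\mathcal F$ with GNS representation $(\pi_\omega,\mathcal H_\omega,\Omega_\omega)$, and let $\mathcal C\subset\pi_\omega(\mathcal F)'$ be a commutative C*-subalgebra of $\mathcal B(\mathcal H_\omega)$ containing the identity operator, where primes denote commutants in $\mathcal B(\mathcal H_\omega)$. Let $X$ be the spectrum (character space) of $\mathcal C$, a compact Hausdorff space, and for a unital C*-algebra $\mathcal A$ let $\mathfrak S(\mathcal A)$ denote its set of states. Then there are a regular Borel probability measure $\mu$ on $X$ with $\operatorname{supp}\mu=X$, an isometric $*$-isomorphism $\Phi:\mathcal C''\to L^\infty(X,\mu)$ onto $L^\infty(X,\mu)$ which extends the Gelfand transform of $\mathcal C$ (that is, for $C\in\mathcal C$, $\Phi(C)(x)=x(C)$ for $\mu$-almost every $x$), and a map $\psi:X\to\mathfrak S(\mathcal C')$, $x\mapsto\psi_x$, such that: (i) for every $A\in\mathcal C'$ the function $x\mapsto\psi_x(A)$ is in $L^\infty(X,\mu)$; (ii) for every $A\in\mathcal C'$, $\widetilde\omega(A):=(\Omega_\omega,A\Omega_\omega)=\int_X\psi_x(A)\,d\mu(x)$;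 (iii) for every $C\in\mathcal C''$ and every $A\in\mathcal C'$, $\psi_x(CA)=\Phi(C)(x)\,\psi_x(A)$ for $\mu$-almost every $x\in X$ (the exceptional null set may depend on $C$ and $A$). If moreover $\mathcal C$ is a von Neumann algebra ($\mathcal C=\mathcal C''$), then $\psi$ can be chosen so that, in addition, for every $A\in\mathcal C'$ the function $x\mapsto\psi_x(A)$ is continuous on $X$, and $\psi_x(CA)=x(C)\,\psi_x(A)$ holds for every $x\in X$, $C\in\mathcal C$ and $A\in\mathcal C'$. -/

import Mathlib

open MeasureTheory
open scoped ENNReal ComplexOrder InnerProductSpace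

/-- A state of a C⋆-algebra, unital or not: a bounded linear functional that is positive and
has norm one. -/
structure CStarState (A : Type*) [NonUnitalNormedRing A] [NormedSpace ℂ A] [Star A] where
  toCLM : A →L[ℂ] ℂ
  nonneg : ∀ a : A, 0 ≤ toCLM (star a * a)
  norm_eq_one : ‖toCLM‖ = 1

noncomputable instance (A : Type*) [NonUnitalNormedRing A] [NormedSpace ℂ A] [Star A] :
    CoeFun (CStarState A) (fun _ => A → ℂ) :=
  ⟨fun φ => ⇑φ.toCLM⟩

namespace CStarState

variable {F : Type*} [NonUnitalCStarAlgebra F] [PartialOrder F] [StarOrderedRing F]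
variable (ω : CStarState F)

/-- A state as a positive linear map. -/
noncomputable def toPositive : F →ₚ[ℂ] ℂ :=
  PositiveLinearMap.mk₀ (ω.toCLM : F →ₗ[ℂ] ℂ) (by
    intro a ha
    obtain ⟨b, rfl⟩ := CStarAlgebra.nonneg_iff_eq_star_mul_self.mp ha
    exact ω.nonneg b)

theorem toPositive_apply (a : F) : ω.toPositive a = ω a := rfl

/-- The Hilbert space `H_ω` of the GNS representation of `ω`. -/
abbrev HilbertSpace : Type _ := ω.toPositive.GNS

/-- The GNS representation `π_ω` of `F` on `H_ω`. -/
noncomputable def gnsRep : F →⋆ₙₐ[ℂ] (ω.HilbertSpace →L[ℂ] ω.HilbertSpace) :=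
  ω.toPositive.gnsNonUnitalStarAlgHom

open Filter Topology in
theorem norm_apply_le_norm_preGNS (a : F) : ‖ω a‖ ≤ ‖ω.toPositive.toPreGNS a‖ := by
  have hl := CStarAlgebra.increasingApproximateUnit F
  have := hl.neBot
  have h1 : Tendsto (fun e : F => ‖ω (e * a)‖) (CStarAlgebra.approximateUnit F) (𝓝 ‖ω a‖) :=
    ((ω.toCLM.continuous.tendsto _).comp (hl.tendsto_mul_right a)).norm
  refine le_of_tendsto h1 ?_
  filter_upwards [hl.eventually_norm, hl.eventually_star_eq] with e he hs
  have h2 := norm_inner_le_norm (𝕜 := ℂ) (ω.toPositive.toPreGNS e) (ω.toPositive.toPreGNS a)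
  rw [PositiveLinearMap.preGNS_inner_def] at h2
  simp only [PositiveLinearMap.ofPreGNS_toPreGNS, hs, toPositive_apply] at h2
  refine h2.trans (mul_le_of_le_one_left (norm_nonneg _) ?_)
  rw [PositiveLinearMap.preGNS_norm_def, Real.sqrt_le_one]
  simp only [PositiveLinearMap.ofPreGNS_toPreGNS, hs, toPositive_apply]
  calc (ω.toCLM (e * e)).re ≤ ‖ω.toCLM (e * e)‖ := Complex.re_le_norm _
    _ ≤ ‖ω.toCLM‖ * ‖e * e‖ := ω.toCLM.le_opNorm _
    _ ≤ 1 * (1 * 1) := by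
      rw [ω.norm_eq_one]
      gcongr
      exact (norm_mul_le _ _).trans (by gcongr)
    _ = 1 := by norm_num

/-- The functional on the GNS space that extends `[a] ↦ ω(a)`. -/
noncomputable def gnsFunctional : ω.HilbertSpace →L[ℂ] ℂ :=
  (LinearMap.mkContinuous
    ((ω.toCLM : F →ₗ[ℂ] ℂ) ∘ₗ (ω.toPositive.ofPreGNS : ω.toPositive.PreGNS →ₗ[ℂ] F)) 1
    (fun x => by simpa using ω.norm_apply_le_norm_preGNS (ω.toPositive.ofPreGNS x))).fromCompletion

/-- The canonical cyclic vector `Ω_ω`: the vector of `H_ω` with `⟪Ω_ω, [a]⟫ = ω(a)` for every `a`.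
In the unital case it is the class of the unit. -/
noncomputable def cyclicVector : ω.HilbertSpace :=
  (InnerProductSpace.toDual ℂ ω.HilbertSpace).symm ω.gnsFunctional

/-- The defining property of `Ω_ω`. -/
theorem inner_cyclicVector (a : F) :
    ⟪ω.cyclicVector, (ω.toPositive.toPreGNS a : ω.HilbertSpace)⟫_ℂ = ω a := by
  simp [cyclicVector, gnsFunctional]

end CStarState

section Commutant

variable {H : Type*} [NormedAddCommGroup H] [InnerProductSpace ℂ H] [CompleteSpace H]

/-- The commutant `C'` of a ⋆-algebra `C` of bounded operators. -/
noncomputable abbrev commutant (C : StarSubalgebra ℂ (H →L[ℂ] H)) :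
    StarSubalgebra ℂ (H →L[ℂ] H) :=
  StarSubalgebra.centralizer ℂ (C : Set (H →L[ℂ] H))

theorem mem_commutant {C : StarSubalgebra ℂ (H →L[ℂ] H)} {T : H →L[ℂ] H} :
    T ∈ commutant C ↔ ∀ S ∈ C, S * T = T * S := by
  rw [StarSubalgebra.mem_centralizer_iff]
  exact ⟨fun h S hS => (h S hS).1, fun h S hS => ⟨h S hS, h _ (star_mem hS)⟩⟩

/-- The bicommutant `C''`, the von Neumann algebra generated by `C`. -/
noncomputable abbrev bicommutant (C : StarSubalgebra ℂ (H →L[ℂ] H)) :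
    StarSubalgebra ℂ (H →L[ℂ] H) :=
  commutant (commutant C)

theorem le_bicommutant (C : StarSubalgebra ℂ (H →L[ℂ] H)) : C ≤ bicommutant C :=
  fun _ hT => mem_commutant.mpr fun _ hS => (mem_commutant.mp hS _ hT).symm

theorem bicommutant_le_commutant {C : StarSubalgebra ℂ (H →L[ℂ] H)}
    (hC : ∀ S ∈ C, ∀ T ∈ C, S * T = T * S) : bicommutant C ≤ commutant C :=
  fun _ hT => mem_commutant.mpr fun S hS =>
    mem_commutant.mp hT S (mem_commutant.mpr fun R hR => hC R hR S hS)

/-- The inclusion `C'' ⊆ C'` for a commutative `C`. -/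
noncomputable def bicommutantIncl {C : StarSubalgebra ℂ (H →L[ℂ] H)}
    (hC : ∀ S ∈ C, ∀ T ∈ C, S * T = T * S) : bicommutant C →⋆ₐ[ℂ] commutant C :=
  StarSubalgebra.inclusion (bicommutant_le_commutant hC)

/-- The inclusion `C ⊆ C''`. -/
noncomputable def toBicommutant (C : StarSubalgebra ℂ (H →L[ℂ] H)) : C →⋆ₐ[ℂ] bicommutant C :=
  StarSubalgebra.inclusion (le_bicommutant C)

/-- `C` is a von Neumann algebra on `H`: it equals its bicommutant. -/
def IsVonNeumann (C : StarSubalgebra ℂ (H →L[ℂ] H)) : Prop :=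
  bicommutant C = C

/-- The spectrum of `C`: the characters of `C` with the weak-⋆ topology. -/
abbrev GelfandSpectrum (C : StarSubalgebra ℂ (H →L[ℂ] H)) : Type _ :=
  WeakDual.characterSpace ℂ C

noncomputable instance (C : StarSubalgebra ℂ (H →L[ℂ] H)) : MeasurableSpace (GelfandSpectrum C) := borel _

instance (C : StarSubalgebra ℂ (H →L[ℂ] H)) : BorelSpace (GelfandSpectrum C) := ⟨rfl⟩

/-- `Φ : C'' → L^∞(X, μ)` is an (isometric) ⋆-isomorphism of C⋆-algebras onto `L^∞(X, μ)` that
extends the Gelfand transform `c ↦ (x ↦ x c)` of `C`. -/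
structure IsGelfandIso (C : StarSubalgebra ℂ (H →L[ℂ] H)) (μ : Measure (GelfandSpectrum C))
    (Φ : bicommutant C ≃ₗᵢ[ℂ] Lp ℂ ∞ μ) : Prop where
  map_mul : ∀ S T : bicommutant C, Φ (S * T) =ᵐ[μ] fun x => Φ S x * Φ T x
  map_star : ∀ T : bicommutant C, Φ (star T) =ᵐ[μ] fun x => star (Φ T x)
  map_gelfand : ∀ c : C, Φ (toBicommutant C c) =ᵐ[μ] fun x => x c

end Commutant

/-! As `C` commutes with the GNS representation, the vector `Ω` is cyclic for `C'`, hence separating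
for `C''`. Gelfand duality makes `C` a copy of `C(X)`, and Riesz's theorem turns `f ↦ ⟪Ω, f Ω⟫` into
the measure `μ`; the map `f ↦ f Ω` extends to an isometry `U : L²(μ) → H`. For `A` in `C'`, the
compression `U† A U` commutes with continuous multipliers, so it is multiplication by `h(A) = U† A
Ω`, and `|h(A)| ≤ ‖A‖` almost everywhere (`compression_ae`, `coanalysis_ae_norm_le`). Moreover `∫
h(A) dμ = ⟪Ω, A Ω⟫`.

The projection `U U†` lies in `C'`, so elements of `C''` send `Ω` into the range of `U`, which gives
`h(TA) = h(T) h(A)` for `T` in `C''` (`coanalysis_mul_ae`). Restricted to `C''`, `h` is the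
isomorphism `Φ`: it is injective because `Ω` is separating, and onto because, for bounded `g`, the
map `A Ω ↦ A (U g)` extends to an element of `C''` (`exists_mem_bicommutant_of_Linf`).

It remains to evaluate classes in `L^∞` at points, linearly and contractively. Without any
separability this takes a lifting `l` (`exists_linear_lifting`), obtained from Zorn's lemma and
martingale convergence. Then `ψ_x = l_x ∘ h` is unital and contractive, hence a state. If `C = C''`,
the characters `x ∘ Φ⁻¹` already form a lifting, and this choice gives continuity and the identity
at every point. -/

/-! ### Lifting theorem for finite measures -/

section Lifting

open Filter Topology

variable {X : Type*} {m0 : MeasurableSpace X} {μ : Measure X}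

/-- A sub-σ-algebra together with a family of proper filters finer than the almost everywhere
filter, such that almost every point of a set of the sub-σ-algebra has this set in its filter. This
is a lower density on the sub-σ-algebra, expressed through filters. -/
structure PartialLifting (μ : Measure X) where
  m : MeasurableSpace X
  m_le : m ≤ m0
  filt : X → Filter X
  neBot : ∀ x, (filt x).NeBot
  filt_le_ae : ∀ x, filt x ≤ ae μ
  exists_basis : ∀ x, ∀ S ∈ filt x, ∃ B ∈ filt x, MeasurableSet[m] B ∧ B ≤ᵐ[μ] S
  ae_mem : ∀ E, MeasurableSet[m] E → ∀ᵐ x ∂μ, x ∈ E → E ∈ filt x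

namespace PartialLifting

instance : Preorder (PartialLifting μ) where
  le p q := p.m ≤ q.m ∧ ∀ x, q.filt x ≤ p.filt x
  le_refl p := ⟨le_rfl, fun _ => le_rfl⟩
  le_trans _ _ _ h h' := ⟨h.1.trans h'.1, fun x => (h'.2 x).trans (h.2 x)⟩

theorem not_measure_eq_zero_of_mem (p : PartialLifting μ) {x : X} {S : Set X}
    (hS : S ∈ p.filt x) : μ S ≠ 0 := by
  intro h
  have h1 : Sᶜ ∈ p.filt x := p.filt_le_ae x (by simpa [mem_ae_iff] using h)
  have := p.neBot x
  exact empty_notMem (p.filt x) (by simpa using inter_mem hS h1)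

/-- The trivial partial lifting. -/
def trivial [NeZero μ] : PartialLifting μ where
  m := ⊥
  m_le := bot_le
  filt _ := ae μ
  neBot _ := inferInstance
  filt_le_ae _ := le_rfl
  exists_basis _ S hS := ⟨Set.univ, univ_mem, MeasurableSet.univ, by
    filter_upwards [hS] with x hx _ using hx⟩
  ae_mem E hE := by
    rcases MeasurableSpace.measurableSet_bot_iff.mp hE with rfl | rfl <;> simp

theorem integral_condExp_indicator [IsFiniteMeasure μ] {m : MeasurableSpace X} (hm : m ≤ m0)
    {B E : Set X} (hB : MeasurableSet[m] B) (hE : MeasurableSet[m0] E) :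
    ∫ x in B, (μ[E.indicator (fun _ => (1 : ℝ)) | m]) x ∂μ = μ.real (B ∩ E) := by
  rw [setIntegral_condExp hm ((integrable_const _).indicator hE) hB,
    setIntegral_indicator hE]
  simp

/-- The set `K` where the conditional probability of `D` is positive contains almost all of `D`. If
`Dᶜ` were in the filter at a point with `K` in its filter, some `B` there would almost miss `D`; the
conditional probability would vanish on `B`, so `B ∩ K` would be null. -/
theorem ae_neBot_inf [IsFiniteMeasure μ] (p : PartialLifting μ) {D : Set X}
    (hD : MeasurableSet[m0] D) : ∀ᵐ x ∂μ, x ∈ D → (p.filt x ⊓ 𝓟 D).NeBot := by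
  set h : X → ℝ := μ[D.indicator (fun _ => (1 : ℝ)) | p.m] with hh
  have hmeas : Measurable[p.m] h := stronglyMeasurable_condExp.measurable
  have hnonneg : 0 ≤ᵐ[μ] h :=
    condExp_nonneg (ae_of_all _ fun x => Set.indicator_nonneg (fun _ _ => zero_le_one) x)
  set K : Set X := {x | 0 < h x} with hK
  have hKm : MeasurableSet[p.m] K := hmeas measurableSet_Ioi
  have hDK : μ (Kᶜ ∩ D) = 0 := by
    have h1 := integral_condExp_indicator (μ := μ) p.m_le hKm.compl hD
    have h2 : ∫ x in Kᶜ, h x ∂μ ≤ 0 :=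
      setIntegral_nonpos (p.m_le _ hKm.compl) fun x hx => not_lt.mp hx
    rw [h1] at h2
    exact (measureReal_eq_zero_iff).mp (le_antisymm h2 measureReal_nonneg)
  filter_upwards [p.ae_mem K hKm, measure_eq_zero_iff_ae_notMem.mp hDK] with x hx1 hx2 hxD
  have hxK : K ∈ p.filt x := hx1 (by_contra fun h => hx2 ⟨h, hxD⟩)
  by_contra hne
  rw [not_neBot, inf_principal_eq_bot] at hne
  obtain ⟨B, hB, hBm, hBD⟩ := p.exists_basis x _ hne
  refine p.not_measure_eq_zero_of_mem (inter_mem hB hxK) ?_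
  have h3 : μ (B ∩ D) = 0 := by
    rw [measure_eq_zero_iff_ae_notMem]
    filter_upwards [hBD] with y hy hy'
    exact hy hy'.1 hy'.2
  have h4 : ∫ x in B, h x ∂μ = 0 := by
    rw [hh, integral_condExp_indicator p.m_le hBm hD, measureReal_def, h3]; rfl
  rw [setIntegral_eq_zero_iff_of_nonneg_ae (ae_restrict_of_ae hnonneg)
    integrable_condExp.integrableOn, EventuallyEq, ae_restrict_iff' (p.m_le _ hBm)] at h4
  rw [measure_eq_zero_iff_ae_notMem]
  filter_upwards [h4] with y hy hy'
  exact (hy'.2).ne' (hy hy'.1)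

/-- The σ-algebra generated by `m` and one further set `D`. -/
abbrev adjoinSet (m : MeasurableSpace X) (D : Set X) : MeasurableSpace X where
  MeasurableSet' E := ∃ A B, MeasurableSet[m] A ∧ MeasurableSet[m] B ∧ E = A ∩ D ∪ B ∩ Dᶜ
  measurableSet_empty := ⟨∅, ∅, .empty, .empty, by simp⟩
  measurableSet_compl := by
    rintro _ ⟨A, B, hA, hB, rfl⟩
    refine ⟨Aᶜ, Bᶜ, hA.compl, hB.compl, ?_⟩
    ext x; simp only [Set.mem_compl_iff, Set.mem_union, Set.mem_inter_iff]; tauto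
  measurableSet_iUnion := by
    intro f hf
    choose A B hA hB hf using hf
    refine ⟨⋃ i, A i, ⋃ i, B i, .iUnion hA, .iUnion hB, ?_⟩
    simp only [hf, Set.iUnion_union_distrib, Set.iUnion_inter]

/-- At each `x` one of `D`, `Dᶜ` is added to the filter: the side containing `x` if it is
compatible, which is almost always the case by `ae_neBot_inf`, and otherwise the other side. -/
theorem exists_adjoin [IsFiniteMeasure μ] (p : PartialLifting μ) {D : Set X}
    (hD : MeasurableSet[m0] D) : ∃ q, p ≤ q ∧ MeasurableSet[q.m] D := by
  classical
  let D' : X → Set X := fun x =>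
    if (x ∈ D ∧ (p.filt x ⊓ 𝓟 D).NeBot) ∨ ¬ (p.filt x ⊓ 𝓟 Dᶜ).NeBot then D else Dᶜ
  have hD' : ∀ x, D' x = D ∨ D' x = Dᶜ := fun x => by
    simp only [D']
    split_ifs <;> simp
  have hle : p.m ≤ adjoinSet p.m D := fun A hA => ⟨A, A, hA, hA, by
    rw [← Set.inter_union_distrib_left, Set.union_compl_self, Set.inter_univ]⟩
  have hDm : MeasurableSet[adjoinSet p.m D] D :=
    ⟨Set.univ, ∅, @MeasurableSet.univ _ p.m, @MeasurableSet.empty _ p.m, by simp⟩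
  have hae : ∀ᵐ x ∂μ, x ∈ D' x := by
    filter_upwards [p.ae_neBot_inf hD, p.ae_neBot_inf hD.compl] with x h1 h2
    by_cases hx : x ∈ D
    · simp [D', hx, h1 hx]
    · have := h2 hx
      simp only [D', hx, this, false_and, not_true, or_self, if_false, Set.mem_compl_iff,
        not_false_eq_true]
  refine ⟨{ m := adjoinSet p.m D
            m_le := ?_
            filt := fun x => p.filt x ⊓ 𝓟 (D' x)
            neBot := fun x => ?_
            filt_le_ae := fun x => inf_le_left.trans (p.filt_le_ae x)
            exists_basis := ?_
            ae_mem := ?_ }, ⟨hle, fun x => inf_le_left⟩, hDm⟩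
  · rintro _ ⟨A, B, hA, hB, rfl⟩
    exact ((p.m_le _ hA).inter hD).union ((p.m_le _ hB).inter hD.compl)
  · by_cases h2 : (p.filt x ⊓ 𝓟 Dᶜ).NeBot
    · by_cases h1 : x ∈ D ∧ (p.filt x ⊓ 𝓟 D).NeBot
      · simp [D', h1]
      · simp only [D', h1, h2, not_true, or_self, if_false]
    · have h3 : D ∈ p.filt x := by
        rwa [not_neBot, inf_principal_eq_bot, compl_compl] at h2
      simp only [D', h2, not_false_eq_true, or_true, if_true]
      rw [inf_eq_left.mpr (le_principal_iff.mpr h3)]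
      exact p.neBot x
  · intro x S hS
    rw [mem_inf_principal] at hS
    obtain ⟨B, hB, hBm, hBS⟩ := p.exists_basis x _ hS
    refine ⟨B ∩ D' x, inter_mem (mem_inf_of_left hB) (mem_inf_of_right (mem_principal_self _)),
      ?_, ?_⟩
    · refine @MeasurableSet.inter _ (adjoinSet p.m D) _ _ (hle _ hBm) ?_
      rcases hD' x with h | h <;> rw [h]
      exacts [hDm, hDm.compl]
    · filter_upwards [hBS] with y hy hy'
      exact hy hy'.1 hy'.2
  · rintro _ ⟨A, B, hA, hB, rfl⟩
    filter_upwards [hae, p.ae_mem A hA, p.ae_mem B hB] with x hx hxA hxB hxE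
    rw [mem_inf_principal]
    rcases hD' x with h | h
    · rw [h] at hx ⊢
      have : x ∈ A := by simpa [hx] using hxE
      filter_upwards [hxA this] with y hy hyD using Or.inl ⟨hy, hyD⟩
    · rw [h] at hx ⊢
      have : x ∈ B := by simpa [Set.notMem_of_mem_compl hx] using hxE
      filter_upwards [hxB this] with y hy hyD using Or.inr ⟨hy, hyD⟩

/-- `E` has density at least `1 - ε` on a set of the filter at `x`. -/
def DenseAt (p : PartialLifting μ) (x : X) (ε : ℝ) (E : Set X) : Prop :=
  ∃ G ∈ p.filt x, MeasurableSet[p.m] G ∧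
    ∀ B ⊆ G, MeasurableSet[p.m] B → μ.real (B \ E) ≤ ε * μ.real B

/-- The filter generated by the sets whose densities along a sequence tend to one. -/
def limitFilter [IsFiniteMeasure μ] (p : ℕ → PartialLifting μ) (x : X) : Filter X where
  sets := {S | ∃ E, MeasurableSet[⨆ n, (p n).m] E ∧ E ≤ᵐ[μ] S ∧
    ∀ ε > 0, ∀ᶠ n in atTop, (p n).DenseAt x ε E}
  univ_sets := ⟨Set.univ, .univ, ae_of_all _ fun _ h => h, fun ε hε => .of_forall fun n =>
    ⟨Set.univ, univ_mem, .univ, fun B _ _ => by simpa using by positivity⟩⟩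
  sets_of_superset := by
    rintro S T ⟨E, hE, hES, h⟩ hST
    exact ⟨E, hE, hES.trans (ae_of_all _ hST), h⟩
  inter_sets := by
    rintro S T ⟨E, hE, hES, h⟩ ⟨E', hE', hES', h'⟩
    refine ⟨E ∩ E', hE.inter hE', ?_, fun ε hε => ?_⟩
    · filter_upwards [hES, hES'] with y h1 h2 h3 using ⟨h1 h3.1, h2 h3.2⟩
    · filter_upwards [h (ε / 2) (by positivity), h' (ε / 2) (by positivity)]
      rintro n ⟨G, hG, hGm, hGE⟩ ⟨G', hG', hGm', hGE'⟩
      refine ⟨G ∩ G', inter_mem hG hG', hGm.inter hGm', fun B hB hBm => ?_⟩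
      have h1 := hGE B (hB.trans Set.inter_subset_left) hBm
      have h2 := hGE' B (hB.trans Set.inter_subset_right) hBm
      have h3 : μ.real (B \ (E ∩ E')) ≤ μ.real (B \ E) + μ.real (B \ E') := by
        rw [Set.sdiff_inter]
        exact measureReal_union_le _ _
      linarith

/-- Lévy's upward theorem: the conditional probabilities of `E` tend to one almost everywhere on
`E`, and their superlevel sets witness the density. -/
theorem ae_denseAt [IsFiniteMeasure μ] {p : ℕ → PartialLifting μ} (hp : Monotone p) {E : Set X}
    (hE : MeasurableSet[⨆ n, (p n).m] E) :
    ∀ᵐ x ∂μ, x ∈ E → ∀ ε > 0, ∀ᶠ n in atTop, (p n).DenseAt x ε E := by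
  let ℱ : Filtration ℕ m0 := ⟨fun n => (p n).m, fun i j h => (hp h).1, fun n => (p n).m_le⟩
  have hE0 : MeasurableSet[m0] E := (iSup_le fun n => (p n).m_le) _ hE
  have hint : Integrable (E.indicator fun _ => (1 : ℝ)) μ := (integrable_const _).indicator hE0
  have hlim := hint.tendsto_ae_condExp (ℱ := ℱ)
    ((@stronglyMeasurable_const _ _ (⨆ n, (p n).m) _ (1 : ℝ)).indicator hE)
  set h : ℕ → X → ℝ := fun n => μ[E.indicator (fun _ => (1 : ℝ)) | (p n).m] with hh
  -- Thresholds indexed by `k` keep the exceptional null sets countable in number.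
  let G : ℕ → ℕ → Set X := fun n k => {x | 1 - 1 / ((k : ℝ) + 1) < h n x}
  have hG : ∀ n k, MeasurableSet[(p n).m] (G n k) := fun n k =>
    (stronglyMeasurable_condExp.measurable : Measurable[(p n).m] (h n)) measurableSet_Ioi
  have hmem : ∀ᵐ x ∂μ, ∀ n k, x ∈ G n k → G n k ∈ (p n).filt x :=
    ae_all_iff.mpr fun n => ae_all_iff.mpr fun k => (p n).ae_mem _ (hG n k)
  filter_upwards [hlim, hmem] with x hx hxG hxE ε hε
  obtain ⟨k, hk⟩ := exists_nat_one_div_lt hε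
  have hx' : Tendsto (fun n => h n x) atTop (𝓝 1) := by
    simpa [Set.indicator_of_mem hxE] using hx
  have hkpos : (0 : ℝ) < 1 / ((k : ℝ) + 1) := by positivity
  filter_upwards [hx'.eventually_const_lt (sub_lt_self 1 hkpos)] with n hn
  refine ⟨G n k, hxG n k hn, hG n k, fun B hB hBm => ?_⟩
  have h1 := integral_condExp_indicator (μ := μ) (p n).m_le hBm hE0
  have h2 : ∫ x in B, (1 - 1 / ((k : ℝ) + 1)) ∂μ ≤ ∫ x in B, h n x ∂μ :=
    setIntegral_mono_on (integrable_const _).integrableOn integrable_condExp.integrableOn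
      ((p n).m_le _ hBm) fun y hy => (hB hy).le
  have h3 := measureReal_inter_add_sdiff (μ := μ) (s := B) hE0
  rw [h1] at h2
  simp only [integral_const, measureReal_restrict_apply_univ, smul_eq_mul] at h2
  nlinarith [measureReal_nonneg (μ := μ) (s := B)]

theorem exists_ge_of_monotone [IsFiniteMeasure μ] {p : ℕ → PartialLifting μ} (hp : Monotone p) :
    ∃ q, ∀ n, p n ≤ q := by
  refine ⟨{ m := ⨆ n, (p n).m
            m_le := iSup_le fun n => (p n).m_le
            filt := limitFilter p
            neBot := fun x => ⟨fun h => ?_⟩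
            filt_le_ae := ?_
            exists_basis := ?_
            ae_mem := ?_ }, fun n => ⟨le_iSup (fun n => (p n).m) n, fun x S hS => ?_⟩⟩
  · obtain ⟨E, -, hE, hd⟩ := (empty_mem_iff_bot.mpr h : ∅ ∈ limitFilter p x)
    -- Any `ε < 1` works: the null set `E` cannot fill a fixed part of the non-null set `G`.
    obtain ⟨n, G, hG, hGm, hGE⟩ := (hd (1 / 2) (by norm_num)).exists
    have h1 := hGE G le_rfl hGm
    have h2 : μ.real (G \ E) = μ.real G := measureReal_congr (by
      filter_upwards [hE] with y hy
      exact propext ⟨fun h => h.1, fun h => ⟨h, hy⟩⟩)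
    rw [h2] at h1
    refine (p n).not_measure_eq_zero_of_mem hG ((measureReal_eq_zero_iff).mp ?_)
    linarith [measureReal_nonneg (μ := μ) (s := G)]
  · intro x S hS
    refine ⟨Set.univ, .univ, by filter_upwards [hS] with y hy _ using hy, fun ε hε =>
      .of_forall fun n => ⟨Set.univ, univ_mem, .univ, fun B _ _ => by simpa using by positivity⟩⟩
  · rintro x S ⟨E, hE, hES, h⟩
    exact ⟨E, ⟨E, hE, EventuallyLE.rfl, h⟩, hE, hES⟩
  · intro E hE
    filter_upwards [ae_denseAt hp hE] with x hx hxE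
    exact ⟨E, hE, EventuallyLE.rfl, hx hxE⟩
  · obtain ⟨B, hB, hBm, hBS⟩ := (p n).exists_basis x S hS
    refine ⟨B, le_iSup (fun n => (p n).m) n _ hBm, hBS, fun ε hε => ?_⟩
    filter_upwards [eventually_ge_atTop n] with k hk
    refine ⟨B, (hp hk).2 x hB, (hp hk).1 _ hBm, fun A hA _ => ?_⟩
    rw [Set.sdiff_eq_empty.mpr hA]
    simpa using by positivity

/-- Countably many sets already live in one member of the chain, so the plain union of the
σ-algebras is a σ-algebra and no limit argument is needed. -/
theorem bddAbove_of_countably_bounded {c : Set (PartialLifting μ)} (hc : IsChain (· ≤ ·) c)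
    (hne : c.Nonempty) (hb : ∀ s : ℕ → PartialLifting μ, (∀ n, s n ∈ c) → ∃ p ∈ c, ∀ n, s n ≤ p) :
    BddAbove c := by
  have hdir : ∀ x, Directed (· ≥ ·) (fun p : c => p.1.filt x) := fun x p q => by
    rcases hc.total p.2 q.2 with h | h
    · exact ⟨q, h.2 x, le_rfl⟩
    · exact ⟨p, le_rfl, h.2 x⟩
  have : Nonempty c := hne.to_subtype
  refine ⟨{ m := ⟨fun E => ∃ p ∈ c, MeasurableSet[p.m] E, ?_, ?_, ?_⟩
            m_le := ?_
            filt := fun x => ⨅ p : c, p.1.filt x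
            neBot := fun x => ?_
            filt_le_ae := fun x => ?_
            exists_basis := ?_
            ae_mem := ?_ },
    fun p hp => ⟨fun E hE => ⟨p, hp, hE⟩, fun x => iInf_le_of_le ⟨p, hp⟩ le_rfl⟩⟩
  · exact ⟨hne.some, hne.some_mem, @MeasurableSet.empty _ hne.some.m⟩
  · rintro E ⟨p, hp, hE⟩
    exact ⟨p, hp, hE.compl⟩
  · intro f hf
    choose s hs hf using hf
    obtain ⟨p, hp, hle⟩ := hb s hs
    exact ⟨p, hp, .iUnion fun n => (hle n).1 _ (hf n)⟩
  · rintro E ⟨p, hp, hE⟩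
    exact p.m_le _ hE
  · exact iInf_neBot_of_directed' (hdir x) fun p => p.1.neBot x
  · exact iInf_le_of_le ⟨_, hne.some_mem⟩ (hne.some.filt_le_ae x)
  · intro x S hS
    obtain ⟨p, hp⟩ := (mem_iInf_of_directed (hdir x) S).mp hS
    obtain ⟨B, hB, hBm, hBS⟩ := p.1.exists_basis x S hp
    exact ⟨B, mem_iInf_of_mem p hB, ⟨p, p.2, hBm⟩, hBS⟩
  · rintro E ⟨p, hp, hE⟩
    filter_upwards [p.ae_mem E hE] with x hx hxE
    exact mem_iInf_of_mem ⟨p, hp⟩ (hx hxE)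

/-- Either a sequence is cofinal in the chain, and martingale convergence applies, or every sequence
is bounded within the chain. -/
theorem bddAbove_of_isChain [IsFiniteMeasure μ] {c : Set (PartialLifting μ)}
    (hc : IsChain (· ≤ ·) c) (hne : c.Nonempty) : BddAbove c := by
  by_cases h : ∃ s : ℕ → PartialLifting μ, (∀ n, s n ∈ c) ∧ ∀ p ∈ c, ∃ n, p ≤ s n
  · obtain ⟨s, hs, hcof⟩ := h
    have hdir : Directed (· ≤ ·) s := fun i j => by
      rcases hc.total (hs i) (hs j) with h | h
      · exact ⟨j, h, le_rfl⟩
      · exact ⟨i, le_rfl, h⟩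
    obtain ⟨q, hq⟩ := exists_ge_of_monotone hdir.sequence_mono
    refine ⟨q, fun p hp => ?_⟩
    obtain ⟨n, hn⟩ := hcof p hp
    exact hn.trans ((hdir.le_sequence n).trans (hq _))
  · push Not at h
    refine bddAbove_of_countably_bounded hc hne fun s hs => ?_
    obtain ⟨p, hp, hps⟩ := h s hs
    exact ⟨p, hp, fun n => (hc.total hp (hs n)).resolve_left (hps n)⟩

end PartialLifting

/-- The **lifting theorem**: there is a family of ultrafilters, finer than the almost everywhere
filter, such that almost every point of a measurable set has this set in its ultrafilter. -/
theorem exists_ultrafilter_lifting (μ : Measure X) [IsFiniteMeasure μ] [NeZero μ] :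
    ∃ U : X → Ultrafilter X, (∀ x, (U x : Filter X) ≤ ae μ) ∧
      ∀ E, MeasurableSet E → ∀ᵐ x ∂μ, x ∈ E → E ∈ U x := by
  obtain ⟨p, hp⟩ := zorn_le (α := PartialLifting μ) fun c hc => by
    rcases c.eq_empty_or_nonempty with rfl | hne
    · exact ⟨PartialLifting.trivial, by simp⟩
    · exact PartialLifting.bddAbove_of_isChain hc hne
  -- By maximality, adjoining a set adds nothing new.
  have hall : ∀ E, MeasurableSet E → MeasurableSet[p.m] E := fun E hE => by
    obtain ⟨q, hq, hqE⟩ := p.exists_adjoin hE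
    exact (hp hq).1 _ hqE
  have := p.neBot
  refine ⟨fun x => Ultrafilter.of (p.filt x), fun x =>
    (Ultrafilter.of_le _).trans (p.filt_le_ae x), fun E hE => ?_⟩
  filter_upwards [p.ae_mem E (hall E hE)] with x hx hxE
  exact Ultrafilter.of_le _ (hx hxE)

end Lifting

/-! ### From ultrafilters to a linear lifting of `L^∞` -/

section LinearLifting

open Filter Topology

variable {X : Type*} [MeasurableSpace X] {μ : Measure X}

theorem Lp_ae_norm_le (g : Lp ℂ ∞ μ) : ∀ᵐ x ∂μ, ‖g x‖ ≤ ‖g‖ := by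
  have h := ae_le_eLpNormEssSup (f := g) (μ := μ)
  filter_upwards [h] with x hx
  rw [Lp.norm_def, eLpNorm_exponent_top, ← toReal_enorm]
  refine ENNReal.toReal_mono ?_ hx
  rw [← eLpNorm_exponent_top]
  exact Lp.eLpNorm_ne_top g

/-- The algebra `L^∞` of a finite measure admits a linear lifting of norm one. -/
theorem exists_linear_lifting (μ : Measure X) [IsFiniteMeasure μ] [NeZero μ] :
    ∃ l : X → Lp ℂ ∞ μ →ₗ[ℂ] ℂ, (∀ x g, ‖l x g‖ ≤ ‖g‖) ∧
      (∀ x (g : Lp ℂ ∞ μ), g =ᵐ[μ] (fun _ => 1) → l x g = 1) ∧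
      ∀ g : Lp ℂ ∞ μ, (fun x => l x g) =ᵐ[μ] g := by
  obtain ⟨U, hU, hUE⟩ := exists_ultrafilter_lifting μ
  -- The lifting is the limit along `U x`: it exists by compactness, and it respects almost
  -- everywhere identities since `U x ≤ ae μ`.
  have key : ∀ (x : X) (g : Lp ℂ ∞ μ), ∃ z : ℂ, ‖z‖ ≤ ‖g‖ ∧ Tendsto g (U x) (𝓝 z) := by
    intro x g
    obtain ⟨z, hz, hle⟩ := (isCompact_closedBall (0 : ℂ) ‖g‖).ultrafilter_le_nhds ((U x).map g) (by
      rw [le_principal_iff]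
      change g ⁻¹' _ ∈ (U x : Filter X)
      filter_upwards [hU x (Lp_ae_norm_le g)] with y hy
      simpa using hy)
    exact ⟨z, by simpa using hz, hle⟩
  choose l hl hlim using key
  refine ⟨fun x => ⟨⟨l x, fun g h => ?_⟩, fun c g => ?_⟩, fun x g => hl x g, fun x g hg => ?_,
    fun g => ?_⟩
  · refine tendsto_nhds_unique (hlim x (g + h)) (((hlim x g).add (hlim x h)).congr' ?_)
    filter_upwards [hU x (Lp.coeFn_add g h)] with y hy using hy.symm
  · refine tendsto_nhds_unique (hlim x (c • g)) (((hlim x g).const_smul c).congr' ?_)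
    filter_upwards [hU x (Lp.coeFn_smul c g)] with y hy using hy.symm
  · refine tendsto_nhds_unique (hlim x g) (tendsto_const_nhds.congr' ?_)
    filter_upwards [hU x hg] with y hy using hy.symm
  -- A countable base of `ℂ` leaves one null set outside which `g` tends to `g x` along `U x`.
  · have hB := TopologicalSpace.isBasis_countableBasis ℂ
    have hall : ∀ᵐ x ∂μ, ∀ V ∈ TopologicalSpace.countableBasis ℂ, g x ∈ V → g ⁻¹' V ∈ U x :=
      (ae_ball_iff (TopologicalSpace.countable_countableBasis ℂ)).mpr fun V hV =>
        hUE _ ((Lp.stronglyMeasurable g).measurable (hB.isOpen hV).measurableSet)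
    filter_upwards [hall] with x hx
    refine tendsto_nhds_unique (hlim x g) ?_
    rw [hB.nhds_hasBasis.tendsto_right_iff]
    rintro V ⟨hV, hxV⟩
    exact hx V hV hxV

end LinearLifting

/-! ### Cyclicity and norm of the GNS vector -/

namespace CStarState

variable {F : Type*} [NonUnitalCStarAlgebra F] [PartialOrder F] [StarOrderedRing F]
variable (ω : CStarState F)

/-- Without a unit, `Ω` is known only through its pairings. Against a class `[b]`, both sides give
the conjugate of `ω (star a * b)`. -/
theorem gnsRep_cyclicVector (a : F) :
    ω.gnsRep a ω.cyclicVector = (ω.toPositive.toPreGNS a : ω.HilbertSpace) := by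
  refine ext_inner_left ℂ fun v => ?_
  induction v using UniformSpace.Completion.induction_on with
  | hp => exact isClosed_eq (by fun_prop) (by fun_prop)
  | ih b =>
    obtain ⟨b, rfl⟩ := ω.toPositive.toPreGNS.surjective b
    rw [← ContinuousLinearMap.adjoint_inner_left, ← ContinuousLinearMap.star_eq_adjoint,
      ← map_star, gnsRep, PositiveLinearMap.gnsNonUnitalStarAlgHom_apply_coe,
      PositiveLinearMap.leftMulMapPreGNS_apply, ← inner_conj_symm]
    simp only [PositiveLinearMap.ofPreGNS_toPreGNS]
    rw [inner_cyclicVector, ← inner_conj_symm (𝕜 := ℂ) (ω.toPositive.toPreGNS b : ω.HilbertSpace),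
      UniformSpace.Completion.inner_coe, PositiveLinearMap.preGNS_inner_def]
    simp [toPositive_apply]

theorem dense_range_gnsRep_cyclicVector :
    DenseRange fun a : F => ω.gnsRep a ω.cyclicVector := by
  simp only [gnsRep_cyclicVector]
  exact UniformSpace.Completion.denseRange_coe.comp ω.toPositive.toPreGNS.surjective.denseRange
    (UniformSpace.Completion.continuous_coe _)

theorem norm_cyclicVector : ‖ω.cyclicVector‖ = 1 := by
  refine le_antisymm ?_ ?_
  · rw [cyclicVector, LinearIsometryEquiv.norm_map]
    refine ContinuousLinearMap.opNorm_le_bound _ zero_le_one fun v => ?_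
    induction v using UniformSpace.Completion.induction_on with
    | hp => exact isClosed_le (by fun_prop) (by fun_prop)
    | ih b =>
      simpa [gnsFunctional] using ω.norm_apply_le_norm_preGNS (ω.toPositive.ofPreGNS b)
  · rw [← ω.norm_eq_one]
    refine ContinuousLinearMap.opNorm_le_bound _ (norm_nonneg _) fun a => ?_
    rw [← inner_cyclicVector]
    refine (norm_inner_le_norm _ _).trans ?_
    gcongr
    rw [UniformSpace.Completion.norm_coe, PositiveLinearMap.preGNS_norm_def]
    refine Real.sqrt_le_iff.mpr ⟨norm_nonneg _, ?_⟩
    calc (ω (star a * a)).re ≤ ‖ω (star a * a)‖ := Complex.re_le_norm _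
      _ ≤ ‖ω.toCLM‖ * ‖star a * a‖ := ω.toCLM.le_opNorm _
      _ = ‖a‖ ^ 2 := by rw [ω.norm_eq_one, one_mul, CStarRing.norm_star_mul_self, sq]

end CStarState

/-! ### Gelfand transform and spectral measure -/

section Gelfand

variable {H : Type*} [NormedAddCommGroup H] [InnerProductSpace ℂ H] [CompleteSpace H]

theorem compactSpace_gelfandSpectrum {C : StarSubalgebra ℂ (H →L[ℂ] H)}
    (hclosed : IsClosed (C : Set (H →L[ℂ] H))) : CompactSpace (GelfandSpectrum C) := by
  have : CompleteSpace C := hclosed.completeSpace_coe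
  infer_instance

/-- The inverse of the Gelfand transform of `C`. -/
theorem exists_inverse_gelfand {C : StarSubalgebra ℂ (H →L[ℂ] H)}
    (hclosed : IsClosed (C : Set (H →L[ℂ] H))) (hcomm : ∀ S ∈ C, ∀ T ∈ C, S * T = T * S) :
    ∃ op : C(GelfandSpectrum C, ℂ) →⋆ₐ[ℂ] (H →L[ℂ] H), Function.Injective op ∧
      (∀ f, op f ∈ C) ∧
      ∀ c : C, ∃ f : C(GelfandSpectrum C, ℂ), (∀ x, f x = x c) ∧ op f = c := by
  let _ : CStarAlgebra C := StarSubalgebra.cstarAlgebra C (h_closed := hclosed)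
  let _ : CommCStarAlgebra C :=
    { mul_comm := fun S T => Subtype.ext (hcomm S S.2 T T.2) }
  let e := gelfandStarTransform C
  refine ⟨(C.subtype).comp (e.symm : _ →⋆ₐ[ℂ] C), ?_, fun f => (e.symm f).2,
    fun c => ⟨e c, fun x => rfl, ?_⟩⟩
  · exact Subtype.val_injective.comp e.symm.injective
  · change ((e.symm (e c) : C) : H →L[ℂ] H) = c
    rw [StarAlgEquiv.symm_apply_apply]

variable {X : Type*} [TopologicalSpace X]

/-- A real continuous function as a complex one. -/
def complexify (f : C(X, ℝ)) : C(X, ℂ) := ⟨fun x => (f x : ℂ), by fun_prop⟩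

@[simp]
theorem complexify_apply (f : C(X, ℝ)) (x : X) : complexify f x = (f x : ℂ) := rfl

theorem star_complexify (f : C(X, ℝ)) : star (complexify f) = complexify f := by
  ext x; simp

variable (op : C(X, ℂ) →⋆ₐ[ℂ] (H →L[ℂ] H)) (Ω : H)

theorem inner_op_left (f : C(X, ℂ)) (v w : H) : ⟪op f v, w⟫_ℂ = ⟪v, op (star f) w⟫_ℂ := by
  rw [map_star, ContinuousLinearMap.star_eq_adjoint, ContinuousLinearMap.adjoint_inner_right]

theorem inner_op_complexify (f : C(X, ℝ)) :
    ⟪Ω, op (complexify f) Ω⟫_ℂ = ((⟪Ω, op (complexify f) Ω⟫_ℂ).re : ℂ) := by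
  refine (Complex.conj_eq_iff_re.mp ?_).symm
  rw [inner_conj_symm, inner_op_left, star_complexify]

theorem re_inner_op_nonneg {f : C(X, ℝ)} (hf : 0 ≤ f) :
    0 ≤ (⟪Ω, op (complexify f) Ω⟫_ℂ).re := by
  let s : C(X, ℝ) := ⟨fun x => √(f x), by fun_prop⟩
  have h : complexify f = star (complexify s) * complexify s := by
    ext x
    simp [s, ← Complex.ofReal_mul, Real.mul_self_sqrt (show 0 ≤ f x from hf x)]
  rw [h, map_mul, mul_apply_eq_comp, ← inner_op_left]
  exact inner_self_nonneg (𝕜 := ℂ)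

variable [CompactSpace X] [T2Space X] [MeasurableSpace X] [BorelSpace X]

theorem exists_spectral_measure (hΩ : ‖Ω‖ = 1) :
    ∃ μ : Measure X, IsProbabilityMeasure μ ∧ μ.Regular ∧
      ∀ f : C(X, ℂ), ⟪Ω, op f Ω⟫_ℂ = ∫ x, f x ∂μ := by
  have hadd : ∀ f g : C(X, ℝ), complexify (f + g) = complexify f + complexify g := fun f g => by
    ext x; simp
  let Λ : CompactlySupportedContinuousMap X ℝ →ₚ[ℝ] ℝ :=
    { toFun f := (⟪Ω, op (complexify f.toContinuousMap) Ω⟫_ℂ).re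
      map_add' f g := by
        change (⟪Ω, op (complexify (f.toContinuousMap + g.toContinuousMap)) Ω⟫_ℂ).re = _
        simp [hadd]
      map_smul' c f := by
        have : complexify (c • f).toContinuousMap = (c : ℂ) • complexify f.toContinuousMap := by
          ext x; simp
        rw [this, map_smul, smul_apply, inner_smul_right, Complex.re_ofReal_mul]
        rfl
      monotone' f g h := by
        have h1 := re_inner_op_nonneg op Ω (f := g.toContinuousMap - f.toContinuousMap)
          (fun x => sub_nonneg.mpr (h x))
        have h2 := hadd (g.toContinuousMap - f.toContinuousMap) f.toContinuousMap
        rw [sub_add_cancel] at h2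
        simp only [h2, map_add, add_apply, inner_add_right, Complex.add_re]
        linarith }
  have hreal : ∀ f : C(X, ℝ), ∫ x, f x ∂(RealRMK.rieszMeasure Λ) =
      (⟪Ω, op (complexify f) Ω⟫_ℂ).re := fun f =>
    RealRMK.integral_rieszMeasure Λ ⟨f, HasCompactSupport.of_compactSpace f⟩
  have hcplx : ∀ f : C(X, ℂ), ⟪Ω, op f Ω⟫_ℂ = ∫ x, f x ∂(RealRMK.rieszMeasure Λ) := by
    intro f
    let u : C(X, ℝ) := ⟨fun x => (f x).re, by fun_prop⟩
    let v : C(X, ℝ) := ⟨fun x => (f x).im, by fun_prop⟩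
    have hf : f = complexify u + Complex.I • complexify v := by
      ext x
      simp [u, v, mul_comm Complex.I, Complex.re_add_im]
    have hint : Integrable f (RealRMK.rieszMeasure Λ) :=
      f.continuous.integrable_of_hasCompactSupport (HasCompactSupport.of_compactSpace f)
    have h1 : ∫ x, f x ∂(RealRMK.rieszMeasure Λ) =
        ((∫ x, u x ∂(RealRMK.rieszMeasure Λ) : ℝ) : ℂ) +
          ((∫ x, v x ∂(RealRMK.rieszMeasure Λ) : ℝ) : ℂ) * Complex.I :=
      (integral_re_add_im hint).symm
    rw [h1, hreal, hreal, ← inner_op_complexify, ← inner_op_complexify]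
    conv_lhs => rw [hf]
    rw [map_add, map_smul, add_apply, inner_add_right, smul_apply,
      inner_smul_right, mul_comm]
  refine ⟨RealRMK.rieszMeasure Λ, ⟨?_⟩, inferInstance, hcplx⟩
  have h1 := hcplx 1
  simp only [map_one, one_apply_eq_self, inner_self_eq_norm_sq_to_K, hΩ,
    ContinuousMap.one_apply, integral_const] at h1
  have h2 : (RealRMK.rieszMeasure Λ).real Set.univ = 1 := by
    have := congrArg Complex.re h1
    simpa using this.symm
  rwa [measureReal_def, ENNReal.toReal_eq_one_iff] at h2

end Gelfand

/-! ### Multiplication operators on `L²` -/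

section Multiplication

open Filter Topology

variable {X : Type*} [MeasurableSpace X] {μ : Measure X}

theorem L2_norm_sq_eq_integral (g : Lp ℂ 2 μ) : ‖g‖ ^ 2 = ∫ x, ‖g x‖ ^ 2 ∂μ := by
  have h1 : ⟪g, g⟫_ℂ = ((‖g‖ ^ 2 : ℝ) : ℂ) := by
    rw [inner_self_eq_norm_sq_to_K]; simp
  have h2 : ⟪g, g⟫_ℂ = ((∫ x, ‖g x‖ ^ 2 ∂μ : ℝ) : ℂ) := by
    rw [L2.inner_def, ← integral_complex_ofReal]
    refine integral_congr_ae (ae_of_all _ fun x => ?_)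
    simp only [inner_self_eq_norm_sq_to_K]
    simp
  exact_mod_cast h1.symm.trans h2

theorem L2_integrable_norm_sq (g : Lp ℂ 2 μ) : Integrable (fun x => ‖g x‖ ^ 2) μ :=
  (Lp.memLp g).integrable_norm_pow two_ne_zero

theorem exists_seq_ae_tendsto {u : ℕ → Lp ℂ 2 μ} {g : Lp ℂ 2 μ} (h : Tendsto u atTop (𝓝 g)) :
    ∃ ns : ℕ → ℕ, StrictMono ns ∧ ∀ᵐ x ∂μ, Tendsto (fun i => u (ns i) x) atTop (𝓝 (g x)) :=
  (tendstoInMeasure_of_tendsto_Lp h).exists_seq_tendsto_ae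

variable [IsFiniteMeasure μ]

/-- The indicator function of a measurable set as an element of `L²`. -/
noncomputable def indicatorL2 (μ : Measure X) [IsFiniteMeasure μ] {S : Set X}
    (hS : MeasurableSet S) : Lp ℂ 2 μ :=
  indicatorConstLp 2 hS (measure_ne_top μ S) (1 : ℂ)

theorem indicatorL2_ae {S : Set X} (hS : MeasurableSet S) :
    indicatorL2 μ hS =ᵐ[μ] S.indicator fun _ => (1 : ℂ) :=
  indicatorConstLp_coeFn

variable {V : Lp ℂ 2 μ →L[ℂ] Lp ℂ 2 μ} {k : Lp ℂ 2 μ}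

/-- Testing on indicators gives `∫_S |k|² = ‖V 1_S‖² ≤ ‖V‖² μ(S)` for every measurable `S`. -/
theorem ae_norm_le_of_eq_mul (hV : ∀ g, V g =ᵐ[μ] fun x => g x * k x) :
    ∀ᵐ x ∂μ, ‖k x‖ ≤ ‖V‖ := by
  have h : 0 ≤ᵐ[μ] fun x => ‖V‖ ^ 2 - ‖k x‖ ^ 2 := by
    refine ae_nonneg_of_forall_setIntegral_nonneg
      ((integrable_const _).sub (L2_integrable_norm_sq k)) fun S hS _ => ?_
    have h1 : ‖V (indicatorL2 μ hS)‖ ^ 2 = ∫ x in S, ‖k x‖ ^ 2 ∂μ := by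
      rw [L2_norm_sq_eq_integral, ← integral_indicator hS]
      refine integral_congr_ae ?_
      filter_upwards [hV (indicatorL2 μ hS), indicatorL2_ae hS] with x hx1 hx2
      rw [hx1, hx2]
      by_cases hx : x ∈ S <;> simp [hx]
    have h2 : ‖indicatorL2 μ hS‖ ^ 2 = μ.real S := by
      rw [L2_norm_sq_eq_integral]
      have : ∫ x, ‖indicatorL2 μ hS x‖ ^ 2 ∂μ = ∫ x, S.indicator (fun _ => (1 : ℝ)) x ∂μ := by
        refine integral_congr_ae ?_
        filter_upwards [indicatorL2_ae hS] with x hx2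
        rw [hx2]
        by_cases hx : x ∈ S <;> simp [hx]
      rw [this, integral_indicator hS]
      simp
    rw [integral_sub (integrable_const _).integrableOn (L2_integrable_norm_sq k).integrableOn,
      ← h1]
    simp only [integral_const, measureReal_restrict_apply_univ, smul_eq_mul]
    rw [← h2, ← mul_pow, mul_comm, sub_nonneg]
    exact pow_le_pow_left₀ (norm_nonneg _) (V.le_opNorm _) 2
  filter_upwards [h] with x hx
  exact le_of_sq_le_sq (sub_nonneg.mp hx) (norm_nonneg _)

theorem ae_re_nonneg_of_eq_mul (hV : ∀ g, V g =ᵐ[μ] fun x => g x * k x)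
    (hpos : ∀ g, 0 ≤ (⟪g, V g⟫_ℂ).re) : ∀ᵐ x ∂μ, 0 ≤ (k x).re := by
  have hk : Integrable (fun x => k x) μ := (Lp.memLp k).integrable one_le_two
  refine ae_nonneg_of_forall_setIntegral_nonneg hk.re fun S hS _ => ?_
  have h1 : ⟪indicatorL2 μ hS, V (indicatorL2 μ hS)⟫_ℂ = ∫ x in S, k x ∂μ := by
    rw [L2.inner_def, ← integral_indicator hS]
    refine integral_congr_ae ?_
    filter_upwards [hV (indicatorL2 μ hS), indicatorL2_ae hS] with x hx1 hx2
    rw [hx1, hx2]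
    by_cases hx : x ∈ S <;> simp [hx]
  have h2 := hpos (indicatorL2 μ hS)
  rw [h1] at h2
  exact h2.trans_eq (integral_re (𝕜 := ℂ) hk.integrableOn).symm

variable [TopologicalSpace X] [CompactSpace X] [T2Space X] [BorelSpace X] [μ.Regular]

/-- Multiplication by `k` is not known to be bounded yet, so the limit is taken pointwise, along a
subsequence on which both the approximants and their images converge almost everywhere. -/
theorem ae_eq_mul_of_continuous
    (hV : ∀ f : C(X, ℂ), V (f.toLp 2 μ ℂ) =ᵐ[μ] fun x => f x * k x) (g : Lp ℂ 2 μ) :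
    V g =ᵐ[μ] fun x => g x * k x := by
  obtain ⟨u, hu, hlim⟩ := mem_closure_iff_seq_limit.mp
    (ContinuousMap.toLp_denseRange ℂ μ ℂ (p := 2) (by simp) g)
  choose f hf using hu
  obtain ⟨ns, hns, h1⟩ := exists_seq_ae_tendsto hlim
  obtain ⟨ms, hms, h2⟩ := exists_seq_ae_tendsto
    (((V.continuous.tendsto g).comp hlim).comp hns.tendsto_atTop)
  have h3 : ∀ᵐ x ∂μ, ∀ n, V (u n) x = u n x * k x := ae_all_iff.mpr fun n => by
    rw [← hf n]
    filter_upwards [hV (f n), (f n).coeFn_toLp (p := 2) (𝕜 := ℂ) μ] with x hx1 hx2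
    rw [hx1, hx2]
  filter_upwards [h1, h2, h3] with x hx1 hx2 hx3
  refine tendsto_nhds_unique hx2 ?_
  simp only [Function.comp_apply, hx3]
  exact (hx1.comp hms.tendsto_atTop).mul_const _

end Multiplication

/-! ### The cyclic subspace of `Ω` as `L²(μ)` -/

section CyclicRepresentation

open Filter Topology ContinuousLinearMap

variable {H : Type*} [NormedAddCommGroup H] [InnerProductSpace ℂ H] [CompleteSpace H]
section Compression

variable {X : Type*} [MeasurableSpace X] {μ : Measure X}
variable {U : Lp ℂ 2 μ →ₗᵢ[ℂ] H}

/-- The adjoint of an isometry from `L²` to `H`. -/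
noncomputable def coanalysis (U : Lp ℂ 2 μ →ₗᵢ[ℂ] H) : H →L[ℂ] Lp ℂ 2 μ :=
  adjoint U.toContinuousLinearMap

theorem inner_coanalysis_right (g : Lp ℂ 2 μ) (v : H) :
    ⟪g, coanalysis U v⟫_ℂ = ⟪U g, v⟫_ℂ :=
  adjoint_inner_right _ _ _

theorem inner_coanalysis_left (g : Lp ℂ 2 μ) (v : H) :
    ⟪coanalysis U v, g⟫_ℂ = ⟪v, U g⟫_ℂ :=
  adjoint_inner_left _ _ _

theorem coanalysis_apply_self (g : Lp ℂ 2 μ) : coanalysis U (U g) = g :=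
  ext_inner_left ℂ fun v => by rw [inner_coanalysis_right, LinearIsometry.inner_map_map]

theorem norm_coanalysis_le (v : H) : ‖coanalysis U v‖ ≤ ‖v‖ := by
  refine (le_opNorm _ _).trans ?_
  rw [coanalysis, LinearIsometryEquiv.norm_map]
  exact mul_le_of_le_one_left (norm_nonneg _) U.norm_toContinuousLinearMap_le

/-- The compression `U† A U` of an operator to `L²`. -/
noncomputable def compression (U : Lp ℂ 2 μ →ₗᵢ[ℂ] H) (A : H →L[ℂ] H) :
    Lp ℂ 2 μ →L[ℂ] Lp ℂ 2 μ :=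
  coanalysis U ∘L A ∘L U.toContinuousLinearMap

theorem compression_apply (A : H →L[ℂ] H) (g : Lp ℂ 2 μ) :
    compression U A g = coanalysis U (A (U g)) := rfl

theorem norm_compression_le (A : H →L[ℂ] H) : ‖compression U A‖ ≤ ‖A‖ :=
  opNorm_le_bound _ (norm_nonneg _) fun g => by
    rw [compression_apply]
    refine (norm_coanalysis_le _).trans ((A.le_opNorm _).trans ?_)
    rw [U.norm_map]

end Compression

section Commutation

variable {X : Type*} [TopologicalSpace X] {op : C(X, ℂ) →⋆ₐ[ℂ] (H →L[ℂ] H)}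

theorem commute_op_star {A : H →L[ℂ] H} (hA : ∀ f, op f * A = A * op f) (f : C(X, ℂ)) :
    op f * star A = star A * op f := by
  have h := congrArg star (hA (star f))
  rw [star_mul, star_mul, ← map_star, star_star] at h
  exact h.symm

theorem commute_op_mul {A B : H →L[ℂ] H} (hA : ∀ f, op f * A = A * op f)
    (hB : ∀ f, op f * B = B * op f) (f : C(X, ℂ)) : op f * (A * B) = A * B * op f := by
  rw [← mul_assoc, hA, mul_assoc, hB, mul_assoc]

end Commutation

variable {X : Type*} [TopologicalSpace X] [CompactSpace X] [T2Space X] [MeasurableSpace X]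
  [BorelSpace X] {op : C(X, ℂ) →⋆ₐ[ℂ] (H →L[ℂ] H)} {Ω : H}
variable {μ : Measure X} [IsFiniteMeasure μ] [μ.Regular]

theorem denseRange_toL2 (μ : Measure X) [IsFiniteMeasure μ] [μ.Regular] :
    DenseRange fun f : C(X, ℂ) => f.toLp 2 μ ℂ :=
  ContinuousMap.toLp_denseRange ℂ μ ℂ (p := 2) (by simp)

omit [T2Space X] [μ.Regular] in
theorem norm_toLp_eq_norm_op (hμ : ∀ f : C(X, ℂ), ⟪Ω, op f Ω⟫_ℂ = ∫ x, f x ∂μ) (f : C(X, ℂ)) :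
    ‖op f Ω‖ = ‖f.toLp 2 μ ℂ‖ := by
  have h : ‖op f Ω‖ ^ 2 = ‖f.toLp 2 μ ℂ‖ ^ 2 := by
    have h1 : ⟪op f Ω, op f Ω⟫_ℂ = ((‖op f Ω‖ ^ 2 : ℝ) : ℂ) := by
      rw [inner_self_eq_norm_sq_to_K]; simp
    rw [inner_op_left, ← mul_apply_eq_comp, ← map_mul, hμ] at h1
    rw [L2_norm_sq_eq_integral]
    refine Complex.ofReal_injective (h1.symm.trans ?_)
    rw [← integral_complex_ofReal]
    refine integral_congr_ae ?_
    filter_upwards [f.coeFn_toLp (p := 2) (𝕜 := ℂ) μ] with x hx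
    rw [hx]
    simp [RCLike.star_def, Complex.conj_mul']
  exact (sq_eq_sq₀ (norm_nonneg _) (norm_nonneg _)).mp h

theorem exists_cyclic_isometry (hμ : ∀ f : C(X, ℂ), ⟪Ω, op f Ω⟫_ℂ = ∫ x, f x ∂μ) :
    ∃ U : Lp ℂ 2 μ →ₗᵢ[ℂ] H, ∀ f : C(X, ℂ), U (f.toLp 2 μ ℂ) = op f Ω := by
  let e : C(X, ℂ) →ₗ[ℂ] Lp ℂ 2 μ := (ContinuousMap.toLp 2 μ ℂ : C(X, ℂ) →L[ℂ] Lp ℂ 2 μ)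
  let t : C(X, ℂ) →ₗ[ℂ] H :=
    { toFun f := op f Ω
      map_add' f g := by simp
      map_smul' c f := by rw [map_smul]; rfl }
  have he : DenseRange e := denseRange_toL2 μ
  have ht : ∀ f, t.extendOfNorm e (e f) = t f := LinearMap.extendOfNorm_eq he
    ⟨1, fun f => by rw [one_mul]; exact (norm_toLp_eq_norm_op hμ f).le⟩
  refine ⟨⟨t.extendOfNorm e, fun g => ?_⟩, ht⟩
  refine he.induction_on (p := fun g => ‖t.extendOfNorm e g‖ = ‖g‖) g
    (isClosed_eq (by fun_prop) (by fun_prop)) fun f => ?_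
  rw [ht]
  exact norm_toLp_eq_norm_op hμ f

variable {U : Lp ℂ 2 μ →ₗᵢ[ℂ] H} (hU : ∀ f : C(X, ℂ), U (f.toLp 2 μ ℂ) = op f Ω)

omit [T2Space X] [μ.Regular] in
include hU in
theorem map_one_toLp : U ((1 : C(X, ℂ)).toLp 2 μ ℂ) = Ω := by
  rw [hU, map_one]; rfl

include hU in
theorem coanalysis_op_ae (f : C(X, ℂ)) (v : H) :
    coanalysis U (op f v) =ᵐ[μ] fun x => f x * coanalysis U v x := by
  have hmem : MemLp (fun x => f x * coanalysis U v x) 2 μ :=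
    (Lp.memLp (coanalysis U v)).of_le_mul (c := ‖f‖)
      (f.continuous.aestronglyMeasurable.mul (Lp.aestronglyMeasurable _))
      (ae_of_all _ fun x => by
        rw [norm_mul]
        exact mul_le_mul_of_nonneg_right (f.norm_coe_le_norm x) (norm_nonneg _))
  suffices h : coanalysis U (op f v) = hmem.toLp _ by
    rw [h]; exact hmem.coeFn_toLp
  refine (denseRange_toL2 μ).eq_of_inner_right ℂ fun k => ?_
  have h1 : ⟪k.toLp 2 μ ℂ, coanalysis U (op f v)⟫_ℂ =
      ⟪(star f * k).toLp 2 μ ℂ, coanalysis U v⟫_ℂ := by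
    rw [inner_coanalysis_right, inner_coanalysis_right, hU, hU, map_mul, mul_apply_eq_comp,
      inner_op_left op (star f), star_star]
  rw [h1, L2.inner_def, L2.inner_def]
  refine integral_congr_ae ?_
  filter_upwards [hmem.coeFn_toLp, k.coeFn_toLp (p := 2) (𝕜 := ℂ) μ,
    (star f * k).coeFn_toLp (p := 2) (𝕜 := ℂ) μ] with x h1 h2 h3
  rw [h1, h2, h3]
  simp only [ContinuousMap.mul_apply, ContinuousMap.star_apply, RCLike.inner_apply, map_mul,
    RCLike.star_def, Complex.conj_conj]
  ring

include hU in
theorem compression_ae {A : H →L[ℂ] H} (hA : ∀ f, op f * A = A * op f) (g : Lp ℂ 2 μ) :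
    compression U A g =ᵐ[μ] fun x => g x * coanalysis U (A Ω) x := by
  refine ae_eq_mul_of_continuous (fun f => ?_) g
  rw [compression_apply, hU, ← mul_apply_eq_comp, ← hA, mul_apply_eq_comp]
  exact coanalysis_op_ae hU f _

include hU in
theorem coanalysis_ae_norm_le {A : H →L[ℂ] H} (hA : ∀ f, op f * A = A * op f) :
    ∀ᵐ x ∂μ, ‖coanalysis U (A Ω) x‖ ≤ ‖A‖ := by
  filter_upwards [ae_norm_le_of_eq_mul (compression_ae hU hA)] with x hx
  exact hx.trans (norm_compression_le A)

include hU in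
theorem coanalysis_star_ae {A : H →L[ℂ] H} (hA : ∀ f, op f * A = A * op f) :
    coanalysis U (star A Ω) =ᵐ[μ] fun x => star (coanalysis U (A Ω) x) := by
  suffices h : coanalysis U (star A Ω) = star (coanalysis U (A Ω)) by
    rw [h]; exact Lp.coeFn_star _
  refine ext_inner_left ℂ fun g => ?_
  have h1 : ⟪g, coanalysis U (star A Ω)⟫_ℂ = ⟪compression U A g, (1 : C(X, ℂ)).toLp 2 μ ℂ⟫_ℂ := by
    rw [inner_coanalysis_right, compression_apply, inner_coanalysis_left, map_one_toLp hU,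
      star_eq_adjoint, adjoint_inner_right]
  rw [h1, L2.inner_def, L2.inner_def]
  refine integral_congr_ae ?_
  filter_upwards [compression_ae hU hA g, (1 : C(X, ℂ)).coeFn_toLp (p := 2) (𝕜 := ℂ) μ,
    Lp.coeFn_star (coanalysis U (A Ω))] with x h1 h2 h3
  rw [h1, h2, h3]
  simp [mul_comm]

include hU in
-- With `k ≥ 0` the density of `star A * A`, one has `‖A (U g)‖² = ∫ |g|² k`, while `‖A Ω‖² = ∫ k`.
theorem norm_apply_le_of_ae_norm_le {A : H →L[ℂ] H} (hA : ∀ f, op f * A = A * op f)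
    {g : Lp ℂ 2 μ} {M : ℝ} (hM : 0 ≤ M) (hg : ∀ᵐ x ∂μ, ‖g x‖ ≤ M) :
    ‖A (U g)‖ ≤ M * ‖A Ω‖ := by
  have hB : ∀ f, op f * (star A * A) = star A * A * op f := commute_op_mul (commute_op_star hA) hA
  have hform : ∀ g, ⟪g, compression U (star A * A) g⟫_ℂ = ((‖A (U g)‖ ^ 2 : ℝ) : ℂ) := fun g => by
    rw [compression_apply, inner_coanalysis_right, mul_apply_eq_comp, star_eq_adjoint,
      adjoint_inner_right, inner_self_eq_norm_sq_to_K]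
    simp
  set k := coanalysis U ((star A * A) Ω) with hk
  have hV := compression_ae hU hB
  have hkpos : ∀ᵐ x ∂μ, 0 ≤ (k x).re := ae_re_nonneg_of_eq_mul hV fun g => by
    rw [hform, Complex.ofReal_re]; positivity
  have hkint : Integrable (fun x => k x) μ := (Lp.memLp k).integrable one_le_two
  have hre : ∀ g, ‖A (U g)‖ ^ 2 = ∫ x, ‖g x‖ ^ 2 * (k x).re ∂μ ∧
      Integrable (fun x => ‖g x‖ ^ 2 * (k x).re) μ := fun g => by
    have hint := L2.integrable_inner (𝕜 := ℂ) g (compression U (star A * A) g)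
    have hae : (fun x => (⟪g x, compression U (star A * A) g x⟫_ℂ).re) =ᵐ[μ]
        fun x => ‖g x‖ ^ 2 * (k x).re := by
      filter_upwards [hV g] with x hx
      rw [hx, ← hk, RCLike.inner_apply, mul_comm (g x), mul_assoc, RCLike.mul_conj, mul_comm]
      simp [← Complex.ofReal_pow]
    refine ⟨?_, hint.re.congr hae⟩
    rw [← integral_congr_ae hae, ← Complex.ofReal_re (‖A (U g)‖ ^ 2), ← hform, L2.inner_def]
    exact (integral_re (𝕜 := ℂ) hint).symm
  have h1 := (hre ((1 : C(X, ℂ)).toLp 2 μ ℂ)).1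
  rw [map_one_toLp hU] at h1
  have h2 : ∫ x, ‖(1 : C(X, ℂ)).toLp 2 μ ℂ x‖ ^ 2 * (k x).re ∂μ = ∫ x, (k x).re ∂μ := by
    refine integral_congr_ae ?_
    filter_upwards [(1 : C(X, ℂ)).coeFn_toLp (p := 2) (𝕜 := ℂ) μ] with x hx
    rw [hx]; simp
  have h3 : ‖A (U g)‖ ^ 2 ≤ (M * ‖A Ω‖) ^ 2 := by
    rw [(hre g).1, mul_pow, h1, h2, ← integral_const_mul]
    refine integral_mono_ae (hre g).2 (hkint.re.const_mul _) ?_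
    filter_upwards [hg, hkpos] with x hx1 hx2
    exact mul_le_mul_of_nonneg_right (pow_le_pow_left₀ (norm_nonneg _) hx1 2) hx2
  exact le_of_sq_le_sq h3 (by positivity)

include hU in
-- The range of `U` is invariant under the self-adjoint family `op`, so the projection onto it
-- commutes with that family.
theorem commute_op_projection (f : C(X, ℂ)) :
    op f * (U.toContinuousLinearMap ∘L coanalysis U) =
      (U.toContinuousLinearMap ∘L coanalysis U) * op f := by
  have h1 : ∀ (f : C(X, ℂ)) (g : Lp ℂ 2 μ), U (coanalysis U (op f (U g))) = op f (U g) := by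
    intro f g
    refine (denseRange_toL2 μ).induction_on
      (p := fun g => U (coanalysis U (op f (U g))) = op f (U g)) g
      (isClosed_eq (by fun_prop) (by fun_prop)) fun k => ?_
    rw [hU, ← mul_apply_eq_comp, ← map_mul, ← hU, coanalysis_apply_self]
  ext v
  change op f (U (coanalysis U v)) = U (coanalysis U (op f v))
  rw [← h1]
  refine congrArg U (ext_inner_left ℂ fun g => ?_)
  rw [inner_coanalysis_right, inner_coanalysis_right, ← star_star f, ← inner_op_left,
    ← inner_op_left,
    ← h1, ← inner_coanalysis_left, coanalysis_apply_self, inner_coanalysis_right]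

include hU in
theorem coanalysis_mem_range {T : H →L[ℂ] H}
    (hT : ∀ A : H →L[ℂ] H, (∀ f, op f * A = A * op f) → A * T = T * A) :
    U (coanalysis U (T Ω)) = T Ω := by
  have h := DFunLike.congr_fun (hT _ (commute_op_projection hU)) Ω
  change U (coanalysis U (T Ω)) = T (U (coanalysis U Ω)) at h
  rw [h]
  conv_lhs => rw [← map_one_toLp hU, coanalysis_apply_self, map_one_toLp hU]

include hU in
-- As `T Ω` lies in the range of `U`, `T A Ω = A T Ω = A U (U† T Ω)`, and the compression of `A` is
-- a multiplication operator.
theorem coanalysis_mul_ae {T A : H →L[ℂ] H}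
    (hT : ∀ A : H →L[ℂ] H, (∀ f, op f * A = A * op f) → A * T = T * A)
    (hA : ∀ f, op f * A = A * op f) :
    coanalysis U ((T * A) Ω) =ᵐ[μ] fun x => coanalysis U (T Ω) x * coanalysis U (A Ω) x := by
  rw [← hT A hA, mul_apply_eq_comp, ← coanalysis_mem_range hU hT, ← compression_apply,
    coanalysis_apply_self]
  exact compression_ae hU hA _

end CyclicRepresentation

/-! ### Unital contractive functionals are states -/

section ContractiveState

variable {H : Type*} [NormedAddCommGroup H] [InnerProductSpace ℂ H] [CompleteSpace H]

theorem norm_algebraMap_sub_star_mul_self_le (A : H →L[ℂ] H) :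
    ‖algebraMap ℝ (H →L[ℂ] H) ‖star A * A‖ - star A * A‖ ≤ ‖star A * A‖ := by
  have h0 : 0 ≤ star A * A := star_mul_self_nonneg A
  have h1 : star A * A ≤ algebraMap ℝ (H →L[ℂ] H) ‖star A * A‖ :=
    IsSelfAdjoint.le_algebraMap_norm_self
  rw [CStarAlgebra.norm_le_iff_le_algebraMap _ (norm_nonneg _) (sub_nonneg.mpr h1)]
  exact sub_le_self _ h0

theorem norm_sq_add_I_smul_le {a : H →L[ℂ] H} (ha : IsSelfAdjoint a) (s : ℝ) :
    ‖a + (s * Complex.I : ℂ) • (1 : H →L[ℂ] H)‖ ^ 2 ≤ ‖a‖ ^ 2 + s ^ 2 := by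
  have h1 : star (a + (s * Complex.I : ℂ) • (1 : H →L[ℂ] H)) *
      (a + (s * Complex.I : ℂ) • (1 : H →L[ℂ] H)) = a * a + ((s ^ 2 : ℝ) : ℂ) • 1 := by
    simp only [star_add, star_smul, star_one, ha.star_eq, mul_add, add_mul, smul_mul_assoc,
      mul_smul_comm, one_mul, mul_one]
    have h2 : star (s * Complex.I : ℂ) = -(s * Complex.I) := by simp
    have h3 : (s * Complex.I : ℂ) * -(s * Complex.I) = ((s ^ 2 : ℝ) : ℂ) := by
      push_cast; ring_nf; simp
    rw [h2, smul_add, smul_smul, h3, neg_smul]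
    abel
  rw [sq, ← CStarRing.norm_star_mul_self, h1]
  refine (norm_add_le _ _).trans (add_le_add ((norm_mul_le _ _).trans_eq (sq _).symm) ?_)
  rw [norm_smul, Complex.norm_real, Real.norm_of_nonneg (sq_nonneg s)]
  exact mul_le_of_le_one_right (sq_nonneg s) ContinuousLinearMap.norm_id_le

variable {B : StarSubalgebra ℂ (H →L[ℂ] H)}

/-- A unital contractive functional is positive. -/
theorem nonneg_of_contractive (φ : B →ₗ[ℂ] ℂ) (hb : ∀ A, ‖φ A‖ ≤ ‖A‖) (h1 : φ 1 = 1) (A : B) :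
    0 ≤ φ (star A * A) := by
  set a := star A * A with ha
  have hval : (a : H →L[ℂ] H) = star (A : H →L[ℂ] H) * A := rfl
  have hsa : IsSelfAdjoint (a : H →L[ℂ] H) := by rw [hval]; exact .star_mul_self _
  set M := ‖(a : H →L[ℂ] H)‖ with hM
  have hre : 0 ≤ (φ a).re := by
    have h2 := hb ((M : ℂ) • 1 - a)
    have h3 : ‖(M : ℂ) • (1 : B) - a‖ ≤ M := by
      have := norm_algebraMap_sub_star_mul_self_le (A : H →L[ℂ] H)
      rw [← hval, Algebra.algebraMap_eq_smul_one] at this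
      exact this
    rw [map_sub, map_smul, h1, smul_eq_mul, mul_one] at h2
    have h4 := (Complex.re_le_norm _).trans (h2.trans h3)
    simp only [Complex.sub_re, Complex.ofReal_re] at h4
    linarith
  have him : (φ a).im = 0 := by
    have key : ∀ s : ℝ, (φ a).re ^ 2 + ((φ a).im + s) ^ 2 ≤ M ^ 2 + s ^ 2 := fun s => by
      have h2 := hb (a + (s * Complex.I : ℂ) • 1)
      have h3 := norm_sq_add_I_smul_le hsa s
      have h4 := (pow_le_pow_left₀ (norm_nonneg _) h2 2).trans h3
      rw [map_add, map_smul, h1, smul_eq_mul, mul_one, Complex.sq_norm, Complex.normSq_apply] at h4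
      simp only [Complex.add_re, Complex.add_im, Complex.mul_re, Complex.mul_im, Complex.ofReal_re,
        Complex.ofReal_im, Complex.I_re, Complex.I_im] at h4
      nlinarith
    by_contra hne
    -- In `key` the `s ^ 2` cancels and leaves a term linear in `s`; this `s` makes that term `M ^ 2
    -- + 1`, exceeding the bound `M ^ 2`.
    have h5 := key ((M ^ 2 + 1) / (2 * (φ a).im))
    have h6 : 2 * (φ a).im * ((M ^ 2 + 1) / (2 * (φ a).im)) = M ^ 2 + 1 := by field_simp
    nlinarith [sq_nonneg (φ a).re, sq_nonneg (φ a).im]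
  rw [Complex.nonneg_iff]
  exact ⟨hre, him.symm⟩

/-- The state given by a unital contractive functional. -/
noncomputable def stateOfContractive (φ : B →ₗ[ℂ] ℂ) (hb : ∀ A, ‖φ A‖ ≤ ‖A‖) (h1 : φ 1 = 1) :
    CStarState B where
  toCLM := φ.mkContinuous 1 fun A => by rw [one_mul]; exact hb A
  nonneg := nonneg_of_contractive φ hb h1
  norm_eq_one := by
    refine le_antisymm (LinearMap.mkContinuous_norm_le _ zero_le_one _) ?_
    have h2 := (φ.mkContinuous 1 fun A => by rw [one_mul]; exact hb A).le_opNorm 1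
    rw [LinearMap.mkContinuous_apply, h1, norm_one] at h2
    refine h2.trans (mul_le_of_le_one_right (norm_nonneg _) ?_)
    exact ContinuousLinearMap.norm_id_le (𝕜 := ℂ) (E := H)

end ContractiveState

/-! ### The bicommutant as `L^∞(X, μ)` -/

section Disintegration

variable {H : Type*} [NormedAddCommGroup H] [InnerProductSpace ℂ H] [CompleteSpace H]
variable {C : StarSubalgebra ℂ (H →L[ℂ] H)} {Ω : H}

theorem eq_zero_of_apply_eq_zero (hcyc : DenseRange fun A : commutant C => (A : H →L[ℂ] H) Ω)
    {T : H →L[ℂ] H} (hT : T ∈ bicommutant C) (h : T Ω = 0) : T = 0 := by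
  ext v
  refine hcyc.induction_on (p := fun v => T v = (0 : H →L[ℂ] H) v) v
    (isClosed_eq (by fun_prop) (by fun_prop)) fun A => ?_
  rw [← mul_apply_eq_comp, ← mem_commutant.mp hT A A.2, mul_apply_eq_comp, h]
  simp

variable {X : Type*} [TopologicalSpace X] {op : C(X, ℂ) →⋆ₐ[ℂ] (H →L[ℂ] H)}

theorem mem_commutant_iff_op (hop : ∀ T, T ∈ C ↔ ∃ f, op f = T) {A : H →L[ℂ] H} :
    A ∈ commutant C ↔ ∀ f, op f * A = A * op f := by
  rw [mem_commutant]
  refine ⟨fun h f => h _ ((hop _).mpr ⟨f, rfl⟩), fun h S hS => ?_⟩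
  obtain ⟨f, rfl⟩ := (hop S).mp hS
  exact h f

variable [CompactSpace X] [T2Space X] [MeasurableSpace X] [BorelSpace X]
variable {μ : Measure X} [IsFiniteMeasure μ]

/-- A Urysohn function supported in a null open set would annihilate `Ω`; as `Ω` is separating, it
would be zero. -/
theorem isOpenPosMeasure_of_separating
    (hcyc : DenseRange fun A : commutant C => (A : H →L[ℂ] H) Ω)
    (hinj : Function.Injective op) (hop : ∀ T, T ∈ C ↔ ∃ f, op f = T)
    (hμ : ∀ f : C(X, ℂ), ⟪Ω, op f Ω⟫_ℂ = ∫ x, f x ∂μ) : μ.IsOpenPosMeasure := by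
  refine ⟨fun V hV ⟨x, hx⟩ h0 => ?_⟩
  obtain ⟨f, hf0, hf1, -⟩ := exists_continuous_zero_one_of_isClosed hV.isClosed_compl
    (isClosed_singleton (x := x)) (by simpa using hx)
  have hzero : op (complexify f) Ω = 0 := by
    rw [← norm_eq_zero, norm_toLp_eq_norm_op hμ, norm_eq_zero, Lp.eq_zero_iff_ae_eq_zero]
    filter_upwards [(complexify f).coeFn_toLp (p := 2) (𝕜 := ℂ) μ,
      measure_eq_zero_iff_ae_notMem.mp h0] with y hy hyV
    rw [hy, complexify_apply, hf0 hyV]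
    simp
  have hop0 : op (complexify f) = op 0 := by
    rw [map_zero]
    exact eq_zero_of_apply_eq_zero hcyc (le_bicommutant C ((hop _).mpr ⟨_, rfl⟩)) hzero
  have := DFunLike.congr_fun (hinj hop0) x
  simp [hf1 (Set.mem_singleton x)] at this

variable [μ.Regular] {U : Lp ℂ 2 μ →ₗᵢ[ℂ] H} (hU : ∀ f : C(X, ℂ), U (f.toLp 2 μ ℂ) = op f Ω)
  (hop : ∀ T, T ∈ C ↔ ∃ f, op f = T)

include hU hop in
/-- The map from the commutant to `L^∞` that sends `A` to the density of `T ↦ ⟪Ω, T A Ω⟫`. -/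
theorem exists_densityMap : ∃ h : commutant C →ₗ[ℂ] Lp ℂ ∞ μ,
    (∀ A : commutant C, h A =ᵐ[μ] coanalysis U ((A : H →L[ℂ] H) Ω)) ∧
      ∀ A : commutant C, ‖h A‖ ≤ ‖A‖ := by
  have hb : ∀ A : commutant C, ∀ᵐ x ∂μ, ‖coanalysis U ((A : H →L[ℂ] H) Ω) x‖ ≤ ‖A‖ := fun A =>
    coanalysis_ae_norm_le hU ((mem_commutant_iff_op hop).mp A.2)
  have hmem : ∀ A : commutant C, MemLp (coanalysis U ((A : H →L[ℂ] H) Ω)) ∞ μ := fun A =>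
    memLp_top_of_bound (Lp.aestronglyMeasurable _) ‖A‖ (hb A)
  refine ⟨{ toFun A := (hmem A).toLp _, map_add' := fun A B => ?_, map_smul' := fun c A => ?_ },
    fun A => (hmem A).coeFn_toLp, fun A => ?_⟩
  · refine Lp.ext ?_
    filter_upwards [(hmem (A + B)).coeFn_toLp, (hmem A).coeFn_toLp, (hmem B).coeFn_toLp,
      Lp.coeFn_add ((hmem A).toLp _) ((hmem B).toLp _),
      Lp.coeFn_add (coanalysis U ((A : H →L[ℂ] H) Ω)) (coanalysis U ((B : H →L[ℂ] H) Ω))]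
      with x h1 h2 h3 h4 h5
    rw [h1, h4, Pi.add_apply, h2, h3, ← Pi.add_apply, ← h5, ← map_add]
    rfl
  · refine Lp.ext ?_
    filter_upwards [(hmem (c • A)).coeFn_toLp, (hmem A).coeFn_toLp,
      Lp.coeFn_smul c ((hmem A).toLp _), Lp.coeFn_smul c (coanalysis U ((A : H →L[ℂ] H) Ω))]
      with x h1 h2 h3 h4
    rw [h1, RingHom.id_apply, h3, Pi.smul_apply, h2, ← Pi.smul_apply, ← h4, ← map_smul]
    rfl
  · refine Lp.norm_le_of_ae_bound (norm_nonneg A) ?_ |>.trans_eq ?_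
    · filter_upwards [(hmem A).coeFn_toLp, hb A] with x h1 h2
      exact (congrArg norm h1).trans_le h2
    · simp

include hU hop in
-- The operator is `A Ω ↦ A (U g)`, bounded by `norm_apply_le_of_ae_norm_le`; it commutes with `C'`
-- because it intertwines left multiplications.
theorem exists_mem_bicommutant_of_Linf
    (hcyc : DenseRange fun A : commutant C => (A : H →L[ℂ] H) Ω) (g : Lp ℂ ∞ μ) :
    ∃ T : bicommutant C, ‖T‖ ≤ ‖g‖ ∧ coanalysis U ((T : H →L[ℂ] H) Ω) =ᵐ[μ] g := by
  have hmem : MemLp g 2 μ := (Lp.memLp g).mono_exponent le_top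
  set g2 : Lp ℂ 2 μ := hmem.toLp g with hg2
  have hb : ∀ᵐ x ∂μ, ‖g2 x‖ ≤ ‖g‖ := by
    filter_upwards [hmem.coeFn_toLp, Lp_ae_norm_le g] with x h1 h2
    rwa [hg2, h1]
  let e : commutant C →ₗ[ℂ] H :=
    { toFun A := (A : H →L[ℂ] H) Ω, map_add' _ _ := rfl, map_smul' _ _ := rfl }
  let t : commutant C →ₗ[ℂ] H :=
    { toFun A := (A : H →L[ℂ] H) (U g2), map_add' _ _ := rfl, map_smul' _ _ := rfl }
  have hbound : ∀ A, ‖t A‖ ≤ ‖g‖ * ‖e A‖ := fun A =>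
    norm_apply_le_of_ae_norm_le hU ((mem_commutant_iff_op hop).mp A.2) (norm_nonneg g) hb
  have ht : ∀ A, t.extendOfNorm e (e A) = t A := LinearMap.extendOfNorm_eq hcyc ⟨‖g‖, hbound⟩
  have hT : t.extendOfNorm e ∈ bicommutant C := by
    refine mem_commutant.mpr fun B hB => ?_
    ext v
    refine hcyc.induction_on
      (p := fun v => (B * t.extendOfNorm e) v = (t.extendOfNorm e * B) v) v
      (isClosed_eq (by fun_prop) (by fun_prop)) fun A => ?_
    change B (t.extendOfNorm e (e A)) = t.extendOfNorm e (e (⟨B, hB⟩ * A))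
    rw [ht, ht]
    rfl
  refine ⟨⟨_, hT⟩, ContinuousLinearMap.opNorm_le_bound _ (norm_nonneg g)
    (LinearMap.norm_extendOfNorm_apply_le hcyc ‖g‖ hbound), ?_⟩
  have h1 : t.extendOfNorm e Ω = U g2 := ht 1
  change coanalysis U (t.extendOfNorm e Ω) =ᵐ[μ] g
  rw [h1, coanalysis_apply_self]
  exact hmem.coeFn_toLp

include hU hop in
theorem eq_of_coanalysis_eq (hcyc : DenseRange fun A : commutant C => (A : H →L[ℂ] H) Ω)
    {S T : bicommutant C}
    (h : coanalysis U ((S : H →L[ℂ] H) Ω) = coanalysis U ((T : H →L[ℂ] H) Ω)) : S = T := by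
  have hrange : ∀ R : bicommutant C, U (coanalysis U ((R : H →L[ℂ] H) Ω)) = (R : H →L[ℂ] H) Ω :=
    fun R => coanalysis_mem_range hU fun A hA =>
      mem_commutant.mp R.2 A ((mem_commutant_iff_op hop).mpr hA)
  refine Subtype.ext (sub_eq_zero.mp (eq_zero_of_apply_eq_zero hcyc (S - T).2 ?_))
  change (S : H →L[ℂ] H) Ω - (T : H →L[ℂ] H) Ω = 0
  rw [← hrange S, ← hrange T, h, sub_self]

include hU hop in
-- An injective contraction whose values all have preimages of no larger norm is isometric.
theorem exists_bicommutant_isometry (hcomm : ∀ S ∈ C, ∀ T ∈ C, S * T = T * S)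
    (hcyc : DenseRange fun A : commutant C => (A : H →L[ℂ] H) Ω)
    {h : commutant C →ₗ[ℂ] Lp ℂ ∞ μ}
    (hh : ∀ A : commutant C, h A =ᵐ[μ] coanalysis U ((A : H →L[ℂ] H) Ω))
    (hnorm : ∀ A : commutant C, ‖h A‖ ≤ ‖A‖) :
    ∃ Φ : bicommutant C ≃ₗᵢ[ℂ] Lp ℂ ∞ μ, ∀ T, Φ T = h (bicommutantIncl hcomm T) := by
  let Φ : bicommutant C →ₗ[ℂ] Lp ℂ ∞ μ :=
    { toFun T := h (bicommutantIncl hcomm T)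
      map_add' S T := by rw [map_add, map_add]
      map_smul' c T := by rw [map_smul, map_smul]; rfl }
  have hsurj : ∀ g, ∃ T, ‖T‖ ≤ ‖g‖ ∧ Φ T = g := fun g => by
    obtain ⟨T, hT, hTg⟩ := exists_mem_bicommutant_of_Linf hU hop hcyc g
    exact ⟨T, hT, Lp.ext ((hh _).trans hTg)⟩
  have hinj : Function.Injective Φ := fun S T hST => by
    refine eq_of_coanalysis_eq hU hop hcyc (Lp.ext ((hh (bicommutantIncl hcomm S)).symm.trans ?_))
    change (Φ S : X → ℂ) =ᵐ[μ] _
    rw [hST]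
    exact hh (bicommutantIncl hcomm T)
  have hiso : ∀ T, ‖Φ T‖ = ‖T‖ := fun T => by
    refine le_antisymm (hnorm _) ?_
    obtain ⟨S, hS, hST⟩ := hsurj (Φ T)
    rwa [hinj hST] at hS
  exact ⟨LinearIsometryEquiv.ofSurjective ⟨Φ, hiso⟩ fun g => (hsurj g).imp fun _ hT => hT.2,
    fun T => rfl⟩

end Disintegration

/-! ### Assembling the states `ψ_x` -/

section StateDisintegration

variable {H : Type*} [NormedAddCommGroup H] [InnerProductSpace ℂ H] [CompleteSpace H]
variable {C : StarSubalgebra ℂ (H →L[ℂ] H)}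

/-- A linear lifting of `L^∞`, given by the characters of `C` if `C` is a von Neumann algebra. -/
theorem exists_lifting_of_gelfandIso (hclosed : IsClosed (C : Set (H →L[ℂ] H)))
    {μ : Measure (GelfandSpectrum C)} [IsProbabilityMeasure μ]
    {Φ : bicommutant C ≃ₗᵢ[ℂ] Lp ℂ ∞ μ} (hΦ : IsGelfandIso C μ Φ) :
    ∃ l : GelfandSpectrum C → Lp ℂ ∞ μ →ₗ[ℂ] ℂ, (∀ x g, ‖l x g‖ ≤ ‖g‖) ∧
      (∀ x, l x (Φ 1) = 1) ∧ (∀ g : Lp ℂ ∞ μ, (fun x => l x g) =ᵐ[μ] g) ∧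
      (IsVonNeumann C → ∀ x (c : C), l x (Φ (toBicommutant C c)) = x c) := by
  by_cases hvN : IsVonNeumann C
  · have : CompleteSpace C := hclosed.completeSpace_coe
    let ι : bicommutant C →⋆ₐ[ℂ] C := StarSubalgebra.inclusion (le_of_eq hvN)
    have hι : ∀ T, toBicommutant C (ι T) = T := fun T => rfl
    have hι' : ∀ c, ι (toBicommutant C c) = c := fun c => rfl
    refine ⟨fun x => (WeakDual.CharacterSpace.toCLM x : C →ₗ[ℂ] ℂ) ∘ₗ
      (ι : bicommutant C →ₗ[ℂ] C) ∘ₗ (Φ.symm.toLinearEquiv : Lp ℂ ∞ μ →ₗ[ℂ] bicommutant C),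
      fun x g => ?_, fun x => ?_, fun g => ?_, fun _ x c => ?_⟩
    · change ‖x (ι (Φ.symm g))‖ ≤ ‖g‖
      rw [← Φ.symm.norm_map g]
      exact AlgHom.norm_apply_le_self_mul_norm_one (WeakDual.CharacterSpace.toAlgHom x)
        (ι (Φ.symm g)) |>.trans (mul_le_of_le_one_right (norm_nonneg _)
          (ContinuousLinearMap.norm_id_le (𝕜 := ℂ) (E := H)))
    · change x (ι (Φ.symm (Φ 1))) = 1
      rw [Φ.symm_apply_apply, map_one, map_one]
    · obtain ⟨T, rfl⟩ := Φ.surjective g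
      have h1 := hΦ.map_gelfand (ι T)
      rw [hι] at h1
      filter_upwards [h1] with x hx
      change x (ι (Φ.symm (Φ T))) = _
      rw [Φ.symm_apply_apply, hx]
    · change x (ι (Φ.symm (Φ _))) = x c
      rw [Φ.symm_apply_apply, hι']
  · obtain ⟨l, hl, hl1, hlae⟩ := exists_linear_lifting μ
    refine ⟨l, hl, fun x => hl1 x _ ?_, hlae, fun h => absurd h hvN⟩
    have h1 := hΦ.map_gelfand 1
    rw [map_one] at h1
    filter_upwards [h1] with y hy
    rw [hy, map_one]

theorem exists_state_disintegration {Ω : H} (hΩ : ‖Ω‖ = 1)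
    (hcyc : DenseRange fun A : commutant C => (A : H →L[ℂ] H) Ω)
    (hclosed : IsClosed (C : Set (H →L[ℂ] H)))
    (hcomm : ∀ S ∈ C, ∀ T ∈ C, S * T = T * S) :
    ∃ (μ : Measure (GelfandSpectrum C)) (Φ : bicommutant C ≃ₗᵢ[ℂ] Lp ℂ ∞ μ)
      (ψ : GelfandSpectrum C → CStarState (commutant C)),
      IsProbabilityMeasure μ ∧ μ.Regular ∧ μ.support = Set.univ ∧
      IsGelfandIso C μ Φ ∧
      (∀ A : commutant C, MemLp (fun x => ψ x A) ∞ μ) ∧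
      (∀ A : commutant C, ⟪Ω, (A : H →L[ℂ] H) Ω⟫_ℂ = ∫ x, ψ x A ∂μ) ∧
      (∀ (T : bicommutant C) (A : commutant C),
        (fun x => ψ x (bicommutantIncl hcomm T * A)) =ᵐ[μ] fun x => Φ T x * ψ x A) ∧
      (IsVonNeumann C →
        (∀ A : commutant C, Continuous fun x => ψ x A) ∧
        (∀ (c : C) (A : commutant C) (x : GelfandSpectrum C),
          ψ x (bicommutantIncl hcomm (toBicommutant C c) * A) = x c * ψ x A)) := by
  have := compactSpace_gelfandSpectrum hclosed
  obtain ⟨op, hinj, hopC, hgelf⟩ := exists_inverse_gelfand hclosed hcomm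
  have hop : ∀ T, T ∈ C ↔ ∃ f, op f = T := fun T => by
    refine ⟨fun hT => ?_, ?_⟩
    · obtain ⟨f, -, hf⟩ := hgelf ⟨T, hT⟩
      exact ⟨f, hf⟩
    · rintro ⟨f, rfl⟩
      exact hopC f
  obtain ⟨μ, hprob, hreg, hμ⟩ := exists_spectral_measure op Ω hΩ
  obtain ⟨U, hU⟩ := exists_cyclic_isometry hμ
  obtain ⟨h, hh, hnorm⟩ := exists_densityMap hU hop
  obtain ⟨Φ, hΦ⟩ := exists_bicommutant_isometry hU hop hcomm hcyc hh hnorm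
  have hcommutes : ∀ A : commutant C, ∀ f, op f * (A : H →L[ℂ] H) = A * op f := fun A =>
    (mem_commutant_iff_op hop).mp A.2
  have hmul : ∀ (T : bicommutant C) (A : commutant C),
      h (bicommutantIncl hcomm T * A) =ᵐ[μ] fun x => Φ T x * h A x := fun T A => by
    rw [hΦ]
    filter_upwards [hh (bicommutantIncl hcomm T * A), hh (bicommutantIncl hcomm T), hh A,
      coanalysis_mul_ae hU (T := T) (A := A) (fun B hB =>
        mem_commutant.mp T.2 B ((mem_commutant_iff_op hop).mpr hB)) (hcommutes A)]
      with x h1 h2 h3 h4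
    rw [h1, h2, h3]
    exact h4
  have hiso : IsGelfandIso C μ Φ :=
    { map_mul := fun S T => by
        have := hmul S (bicommutantIncl hcomm T)
        rwa [← map_mul, ← hΦ, ← hΦ] at this
      map_star := fun T => by
        rw [hΦ, hΦ]
        filter_upwards [hh (bicommutantIncl hcomm (star T)), hh (bicommutantIncl hcomm T),
          coanalysis_star_ae hU (hcommutes (bicommutantIncl hcomm T))] with x h1 h2 h3
        rw [h1, h2]
        exact h3
      map_gelfand := fun c => by
        obtain ⟨f, hfx, hf⟩ := hgelf c
        rw [hΦ]
        filter_upwards [hh (bicommutantIncl hcomm (toBicommutant C c)),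
          f.coeFn_toLp (p := 2) (𝕜 := ℂ) μ] with x h1 h2
        rw [h1, ← hfx, ← h2, ← coanalysis_apply_self (U := U) (f.toLp 2 μ ℂ), hU, hf]
        rfl }
  obtain ⟨l, hl, hl1, hlae, hlvN⟩ := exists_lifting_of_gelfandIso hclosed hiso
  have hΦ1 : h 1 = Φ 1 := by rw [hΦ, map_one (bicommutantIncl hcomm)]
  let ψ : GelfandSpectrum C → CStarState (commutant C) := fun x =>
    stateOfContractive (l x ∘ₗ h) (fun A => (hl x _).trans (hnorm A))
      (by rw [LinearMap.comp_apply, hΦ1, hl1])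
  have hψ : ∀ x A, ψ x A = l x (h A) := fun x A => rfl
  have hψae : ∀ A, (fun x => ψ x A) =ᵐ[μ] h A := fun A => hlae (h A)
  have hopen := isOpenPosMeasure_of_separating hcyc hinj hop hμ
  refine ⟨μ, Φ, ψ, hprob, hreg, Measure.support_eq_univ, hiso,
    fun A => (memLp_congr_ae (hψae A)).mpr (Lp.memLp _), fun A => ?_, fun T A => ?_, fun hvN => ?_⟩
  · rw [integral_congr_ae (hψae A), integral_congr_ae (hh A), ← map_one_toLp hU,
      ← inner_coanalysis_right, map_one_toLp hU, L2.inner_def]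
    refine integral_congr_ae ?_
    filter_upwards [(1 : C(GelfandSpectrum C, ℂ)).coeFn_toLp (p := 2) (𝕜 := ℂ) μ] with x hx
    rw [hx]
    simp
  · filter_upwards [hψae (bicommutantIncl hcomm T * A), hψae A, hmul T A] with x h1 h2 h3
    rw [h1, h2, h3]
  -- Here each density is the Gelfand transform of some `c` in `C`, so `ψ_x(A) = x(c)` at every
  -- point.
  · have hrep : ∀ A, ∃ c : C, h A = Φ (toBicommutant C c) := fun A => by
      obtain ⟨T, hT⟩ := Φ.surjective (h A)
      exact ⟨⟨T, hvN.le T.2⟩, hT.symm⟩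
    refine ⟨fun A => ?_, fun c A x => ?_⟩
    · obtain ⟨c, hc⟩ := hrep A
      simp only [hψ, hc, hlvN hvN]
      exact WeakDual.eval_continuous c |>.comp continuous_subtype_val
    · obtain ⟨d, hd⟩ := hrep A
      have h1 : h (bicommutantIncl hcomm (toBicommutant C c) * A) =
          Φ (toBicommutant C (c * d)) := Lp.ext (by
        rw [map_mul (toBicommutant C)]
        filter_upwards [hmul (toBicommutant C c) A,
          hiso.map_mul (toBicommutant C c) (toBicommutant C d)] with y h2 h3
        rw [h2, h3, hd])
      rw [hψ, hψ, h1, hd, hlvN hvN, hlvN hvN, map_mul]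

end StateDisintegration

theorem theorem2p1 {F : Type*} [NonUnitalCStarAlgebra F] [PartialOrder F] [StarOrderedRing F]
    (ω : CStarState F)
    (C : StarSubalgebra ℂ (ω.HilbertSpace →L[ℂ] ω.HilbertSpace))
    (hclosed : IsClosed (C : Set (ω.HilbertSpace →L[ℂ] ω.HilbertSpace)))
    (hcomm : ∀ S ∈ C, ∀ T ∈ C, S * T = T * S)
    (hC : ∀ T ∈ C, ∀ a : F, ω.gnsRep a * T = T * ω.gnsRep a) :
    ∃ (μ : Measure (GelfandSpectrum C)) (Φ : bicommutant C ≃ₗᵢ[ℂ] Lp ℂ ∞ μ)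
      (ψ : GelfandSpectrum C → CStarState (commutant C)),
      IsProbabilityMeasure μ ∧ μ.Regular ∧ μ.support = Set.univ ∧
      IsGelfandIso C μ Φ ∧
      (∀ A : commutant C, MemLp (fun x => ψ x A) ∞ μ) ∧
      (∀ A : commutant C,
        ⟪ω.cyclicVector, (A : ω.HilbertSpace →L[ℂ] ω.HilbertSpace) ω.cyclicVector⟫_ℂ =
          ∫ x, ψ x A ∂μ) ∧
      (∀ (T : bicommutant C) (A : commutant C),
        (fun x => ψ x (bicommutantIncl hcomm T * A)) =ᵐ[μ] fun x => Φ T x * ψ x A) ∧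
      (IsVonNeumann C →
        (∀ A : commutant C, Continuous fun x => ψ x A) ∧
        (∀ (c : C) (A : commutant C) (x : GelfandSpectrum C),
          ψ x (bicommutantIncl hcomm (toBicommutant C c) * A) = x c * ψ x A)) := by
  refine exists_state_disintegration ω.norm_cyclicVector ?_ hclosed hcomm
  -- By `hC` the GNS operators lie in `C'`, so cyclicity passes to `C'`.
  refine ω.dense_range_gnsRep_cyclicVector.mono ?_
  rintro _ ⟨a, rfl⟩
  exact ⟨⟨ω.gnsRep a, mem_commutant.mpr fun S hS => (hC S hS a).symm⟩, rfl⟩
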